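/- Let $Y$ be a Young diagram with $n$ boxes and let $u$ be a nilpotent endomorphism of $V=\mathbb{C}^n$ whose Jordan blocks have the lengths of the rows of $Y$ as their sizes (we write $Y(u)=Y$). Let $\mathcal{B}_u$ be the Springer fiber, i.e. the variety of complete flags $F=(V_0\subset\dots\subset V_n=V)$ with $\dim V_i=i$ and $u(V_i)\subset V_i$ for all $i$. A row-standard tableau of shape $Y$ is a numbering of the boxes of $Y$ by $1,\dots,n$ which increases along the rows; it is standard if it also increases down the columns. For $T$ standard of shape $Y$, let $Y_i^T$ be the shape of the subtableau of entries $1,\dots,i$, let $\mathcal{B}_u^T=\{F\in\mathcal{B}_u : Y(u_{|V_i})=Y_i^T \text{ for } i=1,\dots,n\}$, and let $\mathcal{K}^T=\overline{\mathcal{B}_u^T}$ be its Zariski closure in $\mathcal B_u$. Fix a Jordan basis $(e_x)_{x\in Y}$ of $u$ indexed by the boxes of $Y$: $u(e_x)=0$ if $x$ is in the first column, and $u(e_x)=e_{x'}$ with $x'$ the box just left of $x$ otherwise. For $\tau$ row-standard of shape $Y$, let $F_\tau\in\mathcal{B}_u$ be the flag whose $i$-th space is spanned by the $e_x$ for the boxes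 $x$ with entry at most $i$ in $\tau$. For $0\le i<j\le n$, let $Y_{j/i}(\tau)$ be the Young diagram whose row lengths are, in decreasing order, the numbers of entries from $\{i+1,\dots,j\}$ in the rows of $\tau$, and let $Y_{j/i}^T$ be the shape of the Young tableau obtained by jeu de taquin from the skew subtableau of $T$ of entries $i+1,\dots,j$. Let $\preceq$ be the dominance order on Young diagrams, and write $\tau\preceq T$ if $Y_{j/i}(\tau)\preceq Y_{j/i}^T$ for all $0\le i<j\le n$. Let $\mathbf{K}$ be the set of pairs $(\tau,T)$ of the same shape $Y$ ($\tau$ row-standard, $T$ standard) such that $F_\tau\in\mathcal{K}^T$ for any nilpotent $u$ with $Y(u)=Y$ and any Jordan basis of $u$, and let $\mathbf{R}$ be the set of those pairs with $\tau\preceq T$. **Theorem.** $\mathbf{K}\subset\mathbf{R}$. Moreover, for each $u$ with $Y(u)=Y$, each Jordan basis of $u$ as above, each row-standard $\tau$ and each standard $T$ of shape $Y$: if $F_\tau\in\mathcal{K}^T$, then $Y_{j/i}(\tau)\preceq Y_{j/i}^T$ for all $0\le i<j\le n$. -/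

import Mathlib

/-! ### Tableaux

Boxes of a Young diagram are pairs `(r, c)` (row `r`, column `c`, both counted from `0`).
A numbering of the boxes uses the numbers `1, …, n`, where `n = Y.card`. -/

/-- A row-standard tableau of shape `Y`: a numbering of the boxes by `1, …, n` that increases
along the rows. -/
structure RowStandardTableau (Y : YoungDiagram) where
  /-- the number in a box -/
  entry : Y.cells → ℕ
  bijOn : Set.BijOn entry Set.univ (Set.Icc 1 Y.card)
  row_lt : ∀ x y : Y.cells, x.1.1 = y.1.1 → x.1.2 < y.1.2 → entry x < entry y

/-- A standard tableau of shape `Y`: a numbering of the boxes by `1, …, n` that increases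
along the rows and down the columns. -/
structure StandardTableau (Y : YoungDiagram) extends RowStandardTableau Y where
  col_lt : ∀ x y : Y.cells, x.1.2 = y.1.2 → x.1.1 < y.1.1 → entry x < entry y

theorem StandardTableau.entry_mono {Y : YoungDiagram} (T : StandardTableau Y) {x y : Y.cells}
    (h : x.1 ≤ y.1) : T.entry x ≤ T.entry y := by
  have hm : (x.1.1, y.1.2) ∈ Y.cells :=
    Y.up_left_mem h.1 le_rfl (show (y.1.1, y.1.2) ∈ Y from y.2)
  have h1 : T.entry x ≤ T.entry ⟨_, hm⟩ := by
    rcases h.2.lt_or_eq with h2 | h2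
    · exact (T.row_lt x ⟨_, hm⟩ rfl h2).le
    · have : x = ⟨_, hm⟩ := Subtype.ext (Prod.ext rfl h2)
      rw [← this]
  have h3 : T.entry ⟨_, hm⟩ ≤ T.entry y := by
    rcases h.1.lt_or_eq with h2 | h2
    · exact (T.col_lt ⟨_, hm⟩ y rfl h2).le
    · have : (⟨_, hm⟩ : Y.cells) = y := Subtype.ext (Prod.ext h2 rfl)
      exact (congrArg T.entry this).le
  exact h1.trans h3

/-- The shape `Y_i^T` of the subtableau of `T` with entries `1, …, i`. -/
def StandardTableau.subShape {Y : YoungDiagram} (T : StandardTableau Y) (i : ℕ) :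
    YoungDiagram where
  cells := (Y.cells.attach.filter fun x => T.entry x ≤ i).map (Function.Embedding.subtype _)
  isLowerSet := by
    intro b a hab hb
    simp only [Finset.coe_map, Set.mem_image, Finset.mem_coe, Finset.mem_filter,
      Finset.mem_attach, true_and, Function.Embedding.subtype_apply] at hb ⊢
    obtain ⟨x, hx, rfl⟩ := hb
    have ha : a ∈ Y.cells := Y.isLowerSet hab x.2
    exact ⟨⟨a, ha⟩, (T.entry_mono (x := ⟨a, ha⟩) (y := x) hab).trans hx, rfl⟩

/-- The dominance relation on Young diagrams:
`λ₁ + ⋯ + λ_p ≤ λ'₁ + ⋯ + λ'_p` for all `p`. -/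
def DominatedBy (Y Y' : YoungDiagram) : Prop :=
  ∀ p : ℕ, ∑ k ∈ Finset.range p, Y.rowLen k ≤ ∑ k ∈ Finset.range p, Y'.rowLen k

/-- The number of entries in `{i + 1, …, j}` in the row `r` of `τ`. -/
def RowStandardTableau.rowSize {Y : YoungDiagram} (τ : RowStandardTableau Y) (i j r : ℕ) : ℕ :=
  (Finset.univ.filter fun x : Y.cells => x.1.1 = r ∧ i < τ.entry x ∧ τ.entry x ≤ j).card

/-- `Y_{j/i}(τ)`: the Young diagram whose row lengths are the sizes of the rows of the subtableau
`τ[i+1, …, j]`, arranged in weakly decreasing order. -/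
def RowStandardTableau.subquotientShape {Y : YoungDiagram} (τ : RowStandardTableau Y)
    (i j : ℕ) : YoungDiagram :=
  YoungDiagram.ofRowLens
    (((Multiset.range (Y.colLen 0)).map (τ.rowSize i j)).sort (· ≥ ·))
    (Multiset.pairwise_sort _ _).sortedGE

/-! ### Jeu de taquin

A partially filled quadrant is a function `ℕ × ℕ → WithTop ℕ`, where `⊤` marks an empty box. -/

/-- The jeu de taquin slide into the empty box `x`: compare the entries in the boxes to the right
of `x` and below `x`, move the smaller one into `x`, and continue with the box so vacated; stop as
soon as both boxes are empty. The first argument bounds the number of moves. -/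
def jdtSlide : ℕ → ℕ × ℕ → (ℕ × ℕ → WithTop ℕ) → (ℕ × ℕ → WithTop ℕ)
  | 0, _, g => g
  | m + 1, x, g =>
    let right : ℕ × ℕ := (x.1, x.2 + 1)
    let below : ℕ × ℕ := (x.1 + 1, x.2)
    if g right = ⊤ ∧ g below = ⊤ then g
    else if g right < g below then
      jdtSlide m right (Function.update (Function.update g x (g right)) right ⊤)
    else
      jdtSlide m below (Function.update (Function.update g x (g below)) below ⊤)

/-- Remove the entry in the corner `(0, 0)` (the smallest entry of a tableau of straight shape) and
slide the rest into the vacated box; `N` bounds the number of moves. -/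
def jdtRemoveMin (N : ℕ) (g : ℕ × ℕ → WithTop ℕ) : ℕ × ℕ → WithTop ℕ :=
  jdtSlide N (0, 0) (Function.update g (0, 0) ⊤)

/-- The subtableau `T[1, …, j]` as a partially filled quadrant. -/
def StandardTableau.filling {Y : YoungDiagram} (T : StandardTableau Y) (j : ℕ) :
    ℕ × ℕ → WithTop ℕ :=
  fun x => if h : x ∈ Y.cells then
    (if T.entry ⟨x, h⟩ ≤ j then (T.entry ⟨x, h⟩ : WithTop ℕ) else ⊤) else ⊤

/-- The Young tableau obtained from the skew tableau `T[i+1, …, j]` by jeu de taquin. The inner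
corners are chosen as follows: starting from `T[1, …, j]`, the entries `1, …, i` are removed one
after the other, each removal being followed by a slide. In every round the vacated box first
moves through the entries `≤ i` still present, to an inner corner of the skew tableau of the
entries `> i`, and from there on the move is a slide of that skew tableau; after `i` rounds only
the entries `i+1, …, j` are left and they fill a Young diagram.
(A slide in `Y` makes fewer than `Y.colLen 0 + Y.rowLen 0` moves.) -/
def StandardTableau.rectification {Y : YoungDiagram} (T : StandardTableau Y) (i j : ℕ) :
    ℕ × ℕ → WithTop ℕ :=
  (jdtRemoveMin (Y.colLen 0 + Y.rowLen 0))^[i] (T.filling j)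

theorem jdtSlide_spec (N : ℕ) : ∀ (m : ℕ) (x : ℕ × ℕ) (g : ℕ × ℕ → WithTop ℕ),
    N ≤ m + (x.1 + x.2) → (∀ y, N ≤ y.1 + y.2 → g y = ⊤) → g x = ⊤ →
    (∀ y z, y ≤ z → y ≠ x → g y ≤ g z) →
    Monotone (jdtSlide m x g) ∧ ∀ y, N ≤ y.1 + y.2 → jdtSlide m x g y = ⊤ := by
  have halt : ∀ (x : ℕ × ℕ) (g : ℕ × ℕ → WithTop ℕ), g x = ⊤ →
      (∀ y z, y ≤ z → y ≠ x → g y ≤ g z) → g (x.1, x.2 + 1) = ⊤ → g (x.1 + 1, x.2) = ⊤ →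
      Monotone g := by
    intro x g hx hg hr hb y z hyz
    by_cases hy : y = x
    · subst hy
      rcases eq_or_ne z y with rfl | hz
      · exact le_rfl
      have : (y.1, y.2 + 1) ≤ z ∨ (y.1 + 1, y.2) ≤ z := by
        have h1 := hyz.1
        have h2 := hyz.2
        rcases h2.lt_or_eq with h | h
        · exact Or.inl ⟨h1, h⟩
        · rcases h1.lt_or_eq with h' | h'
          · exact Or.inr ⟨h', h2⟩
          · exact absurd (Prod.ext h'.symm h.symm) hz
      rcases this with h | h
      · have := hg _ _ h (by intro h; simpa using congrArg Prod.snd h)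
        rw [hr] at this
        exact le_trans le_top this
      · have := hg _ _ h (by intro h; simpa using congrArg Prod.fst h)
        rw [hb] at this
        exact le_trans le_top this
    · exact hg y z hyz hy
  have move : ∀ (x x' : ℕ × ℕ) (g : ℕ × ℕ → WithTop ℕ), x ≤ x' → x ≠ x' → g x = ⊤ →
      (∀ y z, y ≤ z → y ≠ x → g y ≤ g z) → (∀ z, x ≤ z → z ≠ x → g x' ≤ g z) →
      ∀ y z, y ≤ z → y ≠ x' →
        Function.update (Function.update g x (g x')) x' ⊤ y ≤
          Function.update (Function.update g x (g x')) x' ⊤ z := by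
    intro x x' g hle hne hx hg hmin y z hyz hy
    by_cases hz : z = x'
    · subst hz; simp
    rw [Function.update_of_ne hy, Function.update_of_ne hz]
    by_cases hyx : y = x
    · subst hyx
      by_cases hzy : z = y
      · subst hzy; exact le_rfl
      · rw [Function.update_self, Function.update_of_ne hzy]
        exact hmin z hyz hzy
    · rw [Function.update_of_ne hyx]
      by_cases hzx : z = x
      · subst hzx
        rw [Function.update_self]
        exact hg _ _ (hyz.trans hle) hyx
      · rw [Function.update_of_ne hzx]
        exact hg _ _ hyz hyx
  intro m
  induction m with
  | zero =>
    intro x g hN hbox hx hg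
    refine ⟨halt x g hx hg (hbox _ ?_) (hbox _ ?_), hbox⟩ <;> dsimp only <;> omega
  | succ m ih =>
    intro x g hN hbox hx hg
    have hmin : ∀ z, x ≤ z → z ≠ x → g (x.1, x.2 + 1) ≤ g z ∨ g (x.1 + 1, x.2) ≤ g z := by
      intro z hxz hz
      rcases hxz.2.lt_or_eq with h | h
      · exact Or.inl (hg _ _ ⟨hxz.1, h⟩ (by intro h; simpa using congrArg Prod.snd h))
      · rcases hxz.1.lt_or_eq with h' | h'
        · exact Or.inr (hg _ _ ⟨h', hxz.2⟩ (by intro h; simpa using congrArg Prod.fst h))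
        · exact absurd (Prod.ext h'.symm h.symm) hz
    have hbox' : ∀ x' : ℕ × ℕ, g x' ≠ ⊤ → x ≤ x' → ∀ y : ℕ × ℕ, N ≤ y.1 + y.2 →
        Function.update (Function.update g x (g x')) x' ⊤ y = ⊤ := by
      intro x' h' hle y hy
      by_cases hyx' : y = x'
      · subst hyx'; simp
      rw [Function.update_of_ne hyx']
      by_cases hyx : y = x
      · subst hyx
        exact absurd (hbox x' (hy.trans (Nat.add_le_add hle.1 hle.2))) h'
      · rw [Function.update_of_ne hyx]
        exact hbox y hy
    simp only [jdtSlide]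
    split_ifs with h1 h2
    · exact ⟨halt x g hx hg h1.1 h1.2, hbox⟩
    · have hle : x ≤ (x.1, x.2 + 1) := ⟨le_rfl, Nat.le_succ _⟩
      have hne : x ≠ (x.1, x.2 + 1) := by intro h; simpa using congrArg Prod.snd h
      refine ih _ _ (by dsimp only; omega) (hbox' _ (ne_top_of_lt h2) hle) (by simp)
        (move x _ g hle hne hx hg ?_)
      intro z hz hz'
      rcases hmin z hz hz' with h | h
      · exact h
      · exact h2.le.trans h
    · have hle : x ≤ (x.1 + 1, x.2) := ⟨Nat.le_succ _, le_rfl⟩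
      have hne : x ≠ (x.1 + 1, x.2) := by intro h; simpa using congrArg Prod.fst h
      have h3 : g (x.1 + 1, x.2) ≠ ⊤ := by
        intro h
        rw [h] at h2
        exact h1 ⟨not_lt_top_iff.1 h2, h⟩
      refine ih _ _ (by dsimp only; omega) (hbox' _ h3 hle) (by simp)
        (move x _ g hle hne hx hg ?_)
      intro z hz hz'
      rcases hmin z hz hz' with h | h
      · exact (not_lt.1 h2).trans h
      · exact h

theorem StandardTableau.filling_spec {Y : YoungDiagram} (T : StandardTableau Y) (j : ℕ) :
    Monotone (T.filling j) ∧
      ∀ y : ℕ × ℕ, Y.colLen 0 + Y.rowLen 0 ≤ y.1 + y.2 → T.filling j y = ⊤ := by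
  constructor
  · intro y z hyz
    unfold StandardTableau.filling
    by_cases hz : z ∈ Y.cells
    · have hy : y ∈ Y.cells := Y.isLowerSet hyz hz
      have hm := T.entry_mono (x := ⟨y, hy⟩) (y := ⟨z, hz⟩) hyz
      rw [dif_pos hz, dif_pos hy]
      by_cases hj : T.entry ⟨z, hz⟩ ≤ j
      · rw [if_pos hj, if_pos (hm.trans hj)]
        exact_mod_cast hm
      · rw [if_neg hj]
        exact le_top
    · rw [dif_neg hz]
      exact le_top
  · intro y hy
    unfold StandardTableau.filling
    rw [dif_neg]
    intro h
    have h1 : y.1 < Y.colLen 0 :=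
      YoungDiagram.mem_iff_lt_colLen.1
        (Y.up_left_mem le_rfl (Nat.zero_le y.2) (show (y.1, y.2) ∈ Y from h))
    have h2 : y.2 < Y.rowLen 0 :=
      YoungDiagram.mem_iff_lt_rowLen.1
        (Y.up_left_mem (Nat.zero_le y.1) le_rfl (show (y.1, y.2) ∈ Y from h))
    omega

theorem StandardTableau.rectification_mono {Y : YoungDiagram} (T : StandardTableau Y)
    (i j : ℕ) : Monotone (T.rectification i j) := by
  suffices h : Monotone (T.rectification i j) ∧
      ∀ y : ℕ × ℕ, Y.colLen 0 + Y.rowLen 0 ≤ y.1 + y.2 → T.rectification i j y = ⊤ from h.1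
  induction i with
  | zero => exact T.filling_spec j
  | succ i ih =>
    have hs : T.rectification (i + 1) j =
        jdtRemoveMin (Y.colLen 0 + Y.rowLen 0) (T.rectification i j) :=
      Function.iterate_succ_apply' _ _ _
    rw [hs]
    refine jdtSlide_spec _ _ _ _ (by simp) ?_ (by simp) ?_
    · intro y hy
      by_cases h : y = (0, 0)
      · rw [h, Function.update_self]
      · rw [Function.update_of_ne h]
        exact ih.2 y hy
    · intro y z hyz hy
      have hz : z ≠ (0, 0) := by
        rintro rfl
        exact hy (Prod.ext (Nat.le_zero.1 hyz.1) (Nat.le_zero.1 hyz.2))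
      rw [Function.update_of_ne hy, Function.update_of_ne hz]
      exact ih.1 hyz

/-- `Y_{j/i}^T`: the shape of the Young tableau obtained from `T[i+1, …, j]` by jeu de taquin. -/
def StandardTableau.subquotientShape {Y : YoungDiagram} (T : StandardTableau Y) (i j : ℕ) :
    YoungDiagram where
  cells := Y.cells.filter fun x => T.rectification i j x ≠ ⊤
  isLowerSet := by
    intro b a hab hb
    simp only [Finset.coe_filter, Set.mem_ofPred_eq] at hb ⊢
    exact ⟨Y.isLowerSet hab hb.1, ne_top_of_le_ne_top hb.2 (T.rectification_mono i j hab)⟩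

/-- The relation `τ ⪯ T`. -/
def TableauDominatedBy {Y : YoungDiagram} (τ : RowStandardTableau Y) (T : StandardTableau Y) :
    Prop :=
  ∀ i j : ℕ, i < j → j ≤ Y.card → DominatedBy (τ.subquotientShape i j) (T.subquotientShape i j)

/-! ### Jordan bases and flags -/

/-- `e` is a Jordan basis of `f` indexed by the boxes of `Y`: a vector in the first column is
killed by `f`, any other one is sent to its left neighbour. (In particular `f` is nilpotent and its
Jordan blocks have the sizes of the rows of `Y`.) -/
def IsJordanBasis {W : Type*} [AddCommGroup W] [Module ℂ W] {Y : YoungDiagram}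
    (f : Module.End ℂ W) (e : Module.Basis Y.cells ℂ W) : Prop :=
  (∀ x : Y.cells, x.1.2 = 0 → f (e x) = 0) ∧
  (∀ x x' : Y.cells, x.1.1 = x'.1.1 → x.1.2 = x'.1.2 + 1 → f (e x) = e x')

/-- `Y(f) = Y`: `f` is nilpotent and its Jordan form has blocks of sizes the row lengths of `Y`. -/
def HasJordanType {W : Type*} [AddCommGroup W] [Module ℂ W]
    (f : Module.End ℂ W) (Y : YoungDiagram) : Prop :=
  ∃ e : Module.Basis Y.cells ℂ W, IsJordanBasis f e

/-- Complete flags `V_0 ⊂ V_1 ⊂ ⋯ ⊂ V_n` of `ℂⁿ`, with `dim V_i = i`. -/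
@[ext]
structure CompleteFlag (n : ℕ) where
  /-- the members of the flag -/
  space : Fin (n + 1) → Submodule ℂ (Fin n → ℂ)
  mono : Monotone space
  finrank_eq : ∀ i, Module.finrank ℂ (space i) = i

theorem finrank_span_basis_image {W ι : Type*} [AddCommGroup W] [Module ℂ W] [Fintype ι]
    (e : Module.Basis ι ℂ W) (s : Set ι) :
    Module.finrank ℂ (Submodule.span ℂ (e '' s)) = s.ncard := by
  classical
  have h : LinearIndependent ℂ (fun x : s => e x) :=
    e.linearIndependent.comp _ Subtype.val_injective
  have := finrank_span_eq_card h
  rw [Set.image_eq_range, this, ← Nat.card_eq_fintype_card, Nat.card_coe_set_eq]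

/-- The flag `(⟨b_1, …, b_i⟩)_i` of a basis `b` of `ℂⁿ`. -/
def flagOfBasis {n : ℕ} (b : Module.Basis (Fin n) ℂ (Fin n → ℂ)) : CompleteFlag n where
  space := b.flag
  mono := b.flag_mono
  finrank_eq i := by
    rw [Module.Basis.flag, finrank_span_basis_image]
    have : {k : Fin n | k.castSucc < i} = Fin.castSucc ⁻¹' Set.Iio i := rfl
    rw [Set.ncard_eq_toFinset_card']
    have h2 : (({k : Fin n | k.castSucc < i} : Set (Fin n)).toFinset).map Fin.castSuccEmb
        = Finset.Iio i := by
      ext k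
      simp only [Finset.mem_map, Set.mem_toFinset, Set.mem_ofPred_eq, Finset.mem_Iio]
      constructor
      · rintro ⟨a, ha, rfl⟩
        exact ha
      · intro hk
        have hk' : (k : ℕ) < n := lt_of_lt_of_le hk (Nat.lt_succ_iff.1 i.2)
        exact ⟨⟨k, hk'⟩, hk, rfl⟩
    rw [← Finset.card_map Fin.castSuccEmb, h2, Fin.card_Iio]

/-- Zariski closed subsets of the variety of complete flags of `ℂⁿ`. This variety is the quotient
of `GL(ℂⁿ)`, that is, of the variety of bases `b` of `ℂⁿ`, under `b ↦ (⟨b_1, …, b_i⟩)_i`, with the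
quotient topology: a set of flags is closed if and only if the bases whose flag lies in it are cut
out by polynomials in the coordinates of the basis vectors. -/
def IsZariskiClosed {n : ℕ} (Z : Set (CompleteFlag n)) : Prop :=
  ∃ S : Set (MvPolynomial (Fin n × Fin n) ℂ), ∀ b : Module.Basis (Fin n) ℂ (Fin n → ℂ),
    flagOfBasis b ∈ Z ↔ ∀ p ∈ S, MvPolynomial.eval (fun k => b k.1 k.2) p = 0

/-- The Zariski closure of a set of complete flags. -/
def zariskiClosure {n : ℕ} (A : Set (CompleteFlag n)) : Set (CompleteFlag n) :=
  ⋂₀ {Z | IsZariskiClosed Z ∧ A ⊆ Z}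

/-- The Springer fiber `ℬ_u`: the complete flags stable by `u`. -/
def springerFiber {n : ℕ} (u : Module.End ℂ (Fin n → ℂ)) : Set (CompleteFlag n) :=
  {F | ∀ i, ∀ v ∈ F.space i, u v ∈ F.space i}

/-- The subset `ℬ_u^T`: the flags in the Springer fiber for which the restriction of `u` to `V_i`
has Jordan type `Y_i^T`, for `i = 1, …, n`. -/
def spaltensteinSet {Y : YoungDiagram} (u : Module.End ℂ (Fin Y.card → ℂ))
    (T : StandardTableau Y) : Set (CompleteFlag Y.card) :=
  {F | ∃ h : F ∈ springerFiber u, ∀ i : Fin (Y.card + 1), 1 ≤ (i : ℕ) →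
    HasJordanType (u.restrict (h i)) (T.subShape i)}

/-- The component `𝒦^T`: the Zariski closure of `ℬ_u^T` in the Springer fiber `ℬ_u`. -/
def springerComponent {Y : YoungDiagram} (u : Module.End ℂ (Fin Y.card → ℂ))
    (T : StandardTableau Y) : Set (CompleteFlag Y.card) :=
  springerFiber u ∩ zariskiClosure (spaltensteinSet u T)

/-- The flag `F_τ` with respect to a basis `(e_x)` indexed by the boxes `x` of `Y`:
`V_i` is spanned by the `e_x` for which the number of `x` in `τ` is at most `i`. -/
def tableauFlag {Y : YoungDiagram} (e : Module.Basis Y.cells ℂ (Fin Y.card → ℂ))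
    (τ : RowStandardTableau Y) : CompleteFlag Y.card where
  space i := Submodule.span ℂ (e '' {x | τ.entry x ≤ i})
  mono i j hij := Submodule.span_mono (Set.image_mono fun x (hx : τ.entry x ≤ i) =>
    show τ.entry x ≤ j from hx.trans hij)
  finrank_eq i := by
    rw [finrank_span_basis_image]
    have himg : τ.entry '' {x | τ.entry x ≤ i} = Set.Icc 1 (i : ℕ) := by
      ext k
      constructor
      · rintro ⟨x, hx, rfl⟩
        exact ⟨(τ.bijOn.mapsTo (Set.mem_univ x)).1, hx⟩
      · rintro ⟨h1, h2⟩
        obtain ⟨x, -, rfl⟩ := τ.bijOn.surjOn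
          (show k ∈ Set.Icc 1 Y.card from ⟨h1, h2.trans (Nat.lt_succ_iff.1 i.2)⟩)
        exact ⟨x, h2, rfl⟩
    rw [← Set.InjOn.ncard_image (f := τ.entry)
      (τ.bijOn.injOn.mono (Set.subset_univ _)), himg, Set.ncard_eq_toFinset_card']
    simp

/-- The set `𝐊` for the shape `Y`: the pairs `(τ, T)` with `τ ∈ T`, i.e. such that `F_τ` belongs
to `𝒦^T` for any nilpotent `u` of Jordan type `Y` (and any Jordan basis of `u`). -/
def setK (Y : YoungDiagram) : Set (RowStandardTableau Y × StandardTableau Y) :=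
  {p | ∀ (u : Module.End ℂ (Fin Y.card → ℂ)) (e : Module.Basis Y.cells ℂ (Fin Y.card → ℂ)),
    IsJordanBasis u e → tableauFlag e p.1 ∈ springerComponent u p.2}

/-- The set `𝐑` for the shape `Y`: the pairs `(τ, T)` with `τ ⪯ T`. -/
def setR (Y : YoungDiagram) : Set (RowStandardTableau Y × StandardTableau Y) :=
  {p | TableauDominatedBy p.1 p.2}

/-! ### The local rule of jeu de taquin -/

/-! The rank of u^k on V_j / V_i can only drop under specialisation (`isZariskiClosed_finrank_le`),
and for a nilpotent of type λ the rank of the k-th power is the number of boxes of λ in the columns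
≥ k (`cardFromCol`). So upper bounds on 𝒦^T follow once, for each i, ℬ_u^T lies in the closure of
the flags whose subquotients V_k / V_i have type Y_{k/i}^T for all k ≥ i.

For i = 0 this is the definition of ℬ_u^T. The passage from i to i + 1 (`subquotientSet_subset`)
adjusts V_j / V_{i+1} for one j after another. The shapes Y_{j/i}^T, Y_{j+1/i}^T, Y_{j/i+1}^T,
Y_{j+1/i+1}^T obey the local rule of jeu de taquin (`StandardTableau.subquotientShape_local_rule`).
Linear algebra (`HasSubquotientType.step`) shows that the types of the first three subquotients
force the fourth, unless the line V_{i+1} / V_i is in special position. In that case automorphisms 1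
+ t f, with f commuting with u on V_j modulo V_i, move the line to a good position for infinitely
many t, and the flag is a limit of good ones (`subquotientSet_inter_subset`).

At F_τ the rank of u^k on V_j / V_i is at least ∑ (a - k)₊ over the row sizes a of τ[i+1, …, j]
(`sum_rowSize_le_finrank`). Comparing these sums with those of Y_{j/i}^T for all k gives dominance.
-/

theorem jdtSlide_of_eq_top (m : ℕ) (z : ℕ × ℕ) (g : ℕ × ℕ → WithTop ℕ)
    (hr : g (z.1, z.2 + 1) = ⊤) (hb : g (z.1 + 1, z.2) = ⊤) : jdtSlide m z g = g := by
  cases m with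
  | zero => rfl
  | succ m => simp [jdtSlide, hr, hb]

/-- The effect on a slide of an additional largest entry `v` in the box `x`: the slide either ends
in the same box `e` as before, or it makes one more move, from `e` to `x`. -/
theorem jdtSlide_insert (N : ℕ) (v : WithTop ℕ) (hv : v ≠ ⊤) (x : ℕ × ℕ) (hx : x.1 + x.2 < N) :
    ∀ (m : ℕ) (z : ℕ × ℕ) (g : ℕ × ℕ → WithTop ℕ), N ≤ m + (z.1 + z.2) →
    (∀ y, N ≤ y.1 + y.2 → g y = ⊤) → g z = ⊤ → (∀ y, x ≤ y → g y = ⊤) → x ≠ z →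
    (∀ y, g y ≠ ⊤ → g y < v) →
    (∀ y, jdtSlide m z g y ≠ ⊤ → jdtSlide m z g y < v) ∧
    ∃ e, (e = z ∨ g e ≠ ⊤) ∧ (∀ y, jdtSlide m z g y ≠ ⊤ ↔ (y = z ∨ g y ≠ ⊤) ∧ y ≠ e) ∧
      (jdtSlide m z (Function.update g x v) = Function.update (jdtSlide m z g) x v ∨
        ((x = (e.1, e.2 + 1) ∨ x = (e.1 + 1, e.2)) ∧
          jdtSlide m z (Function.update g x v) = Function.update (jdtSlide m z g) e v)) := by
  have ne_top_iff : ∀ (z : ℕ × ℕ) (g : ℕ × ℕ → WithTop ℕ), g z = ⊤ →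
      ∀ y, g y ≠ ⊤ ↔ (y = z ∨ g y ≠ ⊤) ∧ y ≠ z := by
    intro z g hz y
    constructor
    · intro h
      exact ⟨Or.inr h, by rintro rfl; exact h hz⟩
    · rintro ⟨h | h, h'⟩
      · exact absurd h h'
      · exact h
  intro m
  induction m with
  | zero =>
    intro z g hN hbox hz hxg hxz hg
    exact ⟨hg, z, Or.inl rfl, ne_top_iff z g hz, Or.inl rfl⟩
  | succ m ih =>
    intro z g hN hbox hz hxg hxz hg
    have hx0 : g x = ⊤ := hxg x le_rfl
    -- Once `v` has moved from `x` to `z`, nothing is left at or beyond `x`, so the slide stops.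
    have last : ∀ k, z ≤ x → jdtSlide k x
        (Function.update (Function.update (Function.update g x v) z v) x ⊤) =
          Function.update g z v := by
      intro k hzx
      have h0 : Function.update g x ⊤ = g := by rw [← hx0, Function.update_eq_self]
      have h1 : Function.update (Function.update (Function.update g x v) z v) x ⊤ =
          Function.update g z v := by
        rw [Function.update_comm hxz.symm, Function.update_idem, h0]
      have h2 : ∀ y, x ≤ y → y ≠ x → Function.update g z v y = ⊤ := by
        intro y hy hyx
        rw [Function.update_of_ne (by rintro rfl; exact hyx (le_antisymm hzx hy)), hxg y hy]
      rw [h1]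
      exact jdtSlide_of_eq_top _ _ _
        (h2 _ ⟨le_rfl, Nat.le_succ _⟩ (by intro h; simpa using congrArg Prod.snd h))
        (h2 _ ⟨Nat.le_succ _, le_rfl⟩ (by intro h; simpa using congrArg Prod.fst h))
    -- one move into a neighbour `r` of `z` that holds an entry
    have move : ∀ r : ℕ × ℕ, r.1 + r.2 = z.1 + z.2 + 1 → z ≤ r → g r ≠ ⊤ →
        jdtSlide (m + 1) z g =
          jdtSlide m r (Function.update (Function.update g z (g r)) r ⊤) →
        jdtSlide (m + 1) z (Function.update g x v) =
          jdtSlide m r (Function.update (Function.update (Function.update g x v) z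
            (Function.update g x v r)) r ⊤) →
        (∀ y, jdtSlide (m + 1) z g y ≠ ⊤ → jdtSlide (m + 1) z g y < v) ∧
        ∃ e, (e = z ∨ g e ≠ ⊤) ∧
          (∀ y, jdtSlide (m + 1) z g y ≠ ⊤ ↔ (y = z ∨ g y ≠ ⊤) ∧ y ≠ e) ∧
          (jdtSlide (m + 1) z (Function.update g x v) =
              Function.update (jdtSlide (m + 1) z g) x v ∨
            ((x = (e.1, e.2 + 1) ∨ x = (e.1 + 1, e.2)) ∧
              jdtSlide (m + 1) z (Function.update g x v) =
                Function.update (jdtSlide (m + 1) z g) e v)) := by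
      intro r hr hle hgr h1 h2
      have hrx : r ≠ x := by rintro rfl; exact hgr hx0
      have hrz : r ≠ z := by rintro rfl; omega
      have hval : ∀ y, Function.update (Function.update g z (g r)) r ⊤ y =
          if y = r then ⊤ else if y = z then g r else g y := by
        intro y
        simp only [Function.update_apply]
      have hcomm : Function.update (Function.update (Function.update g x v) z
            (Function.update g x v r)) r ⊤ =
          Function.update (Function.update (Function.update g z (g r)) r ⊤) x v := by
        rw [Function.update_of_ne hrx, Function.update_comm hxz, Function.update_comm hrx.symm]
      rw [h1, h2, hcomm]
      obtain ⟨h3, e, he, h4, h5⟩ := ih r (Function.update (Function.update g z (g r)) r ⊤)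
        (by omega)
        (by
          intro y hy
          rw [hval]
          split_ifs with ha hb
          · rfl
          · subst hb
            exact absurd (hbox r (by omega)) hgr
          · exact hbox y hy)
        (by simp)
        (by
          intro y hy
          rw [hval]
          split_ifs with ha hb
          · rfl
          · subst hb
            exact hxg r (hy.trans hle)
          · exact hxg y hy)
        hrx.symm
        (by
          intro y
          rw [hval]
          split_ifs with ha hb
          · simp
          · exact hg r
          · exact hg y)
      refine ⟨h3, e, ?_, ?_, h5⟩
      · rw [hval] at he
        rcases he with rfl | he
        · exact Or.inr hgr
        · split_ifs at he with ha hb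
          · exact absurd rfl he
          · exact Or.inl hb
          · exact Or.inr he
      · intro y
        rw [h4, hval]
        by_cases ha : y = r
        · subst ha
          simp [hgr]
        · by_cases hb : y = z
          · subst hb
            simp [ha, hgr]
          · simp [ha, hb]
    by_cases hr : g (z.1, z.2 + 1) = ⊤
    · by_cases hb : g (z.1 + 1, z.2) = ⊤
      · rw [jdtSlide_of_eq_top (m + 1) z g hr hb]
        refine ⟨hg, z, Or.inl rfl, ne_top_iff z g hz, ?_⟩
        by_cases hxr : x = (z.1, z.2 + 1)
        · refine Or.inr ⟨Or.inl hxr, ?_⟩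
          rw [← last m (by rw [hxr]; exact ⟨le_rfl, Nat.le_succ _⟩)]
          have h1 : Function.update g x v (z.1 + 1, z.2) = ⊤ := by
            rw [Function.update_of_ne _, hb]
            rw [hxr]; simp
          simp only [jdtSlide]
          rw [h1, ← hxr, Function.update_self]
          simp [hv, lt_top_iff_ne_top]
        · by_cases hxb : x = (z.1 + 1, z.2)
          · refine Or.inr ⟨Or.inr hxb, ?_⟩
            rw [← last m (by rw [hxb]; exact ⟨Nat.le_succ _, le_rfl⟩)]
            have h1 : Function.update g x v (z.1, z.2 + 1) = ⊤ := by
              rw [Function.update_of_ne (Ne.symm hxr), hr]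
            simp only [jdtSlide]
            rw [h1, ← hxb, Function.update_self]
            simp [hv]
          · left
            exact jdtSlide_of_eq_top _ _ _ (by rw [Function.update_of_ne (Ne.symm hxr), hr])
              (by rw [Function.update_of_ne (Ne.symm hxb), hb])
      · refine move (z.1 + 1, z.2) (by dsimp only; omega) ⟨Nat.le_succ _, le_rfl⟩ hb
          (by simp [jdtSlide, hr, hb]) ?_
        have hxb : (z.1 + 1, z.2) ≠ x := by rintro rfl; exact hb hx0
        -- Even if `x` is the right neighbour, its entry `v` exceeds the one below, which still
        -- moves.
        have h1 : ¬ Function.update g x v (z.1, z.2 + 1) < g (z.1 + 1, z.2) := by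
          rw [Function.update_apply]
          split_ifs with h
          · exact (hg _ hb).le.not_gt
          · rw [hr]; simp
        simp only [jdtSlide]
        rw [Function.update_of_ne hxb]
        simp [hb, h1]
    · have hxr : (z.1, z.2 + 1) ≠ x := by rintro rfl; exact hr hx0
      -- If `x` is the lower neighbour, putting `v` in place of `⊤` does not affect the comparison:
      -- the entry on the right is smaller than both.
      have hlt : g (z.1, z.2 + 1) < Function.update g x v (z.1 + 1, z.2) ↔
          g (z.1, z.2 + 1) < g (z.1 + 1, z.2) := by
        rw [Function.update_apply]
        split_ifs with h
        · subst h
          rw [hx0]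
          exact ⟨fun _ => lt_top_iff_ne_top.2 hr, fun _ => hg _ hr⟩
        · rfl
      by_cases hc : g (z.1, z.2 + 1) < g (z.1 + 1, z.2)
      · refine move (z.1, z.2 + 1) (by dsimp only; omega) ⟨le_rfl, Nat.le_succ _⟩ hr
          (by simp [jdtSlide, hr, hc]) ?_
        simp only [jdtSlide]
        rw [Function.update_of_ne hxr]
        simp [hr, hc, hlt]
      · have hb : g (z.1 + 1, z.2) ≠ ⊤ := by
          intro h
          rw [h] at hc
          exact hc (lt_top_iff_ne_top.2 hr)
        refine move (z.1 + 1, z.2) (by dsimp only; omega) ⟨Nat.le_succ _, le_rfl⟩ hb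
          (by simp [jdtSlide, hr, hc]) ?_
        simp only [jdtSlide]
        rw [Function.update_of_ne hxr]
        simp [hr, hc, hlt]

/-! ### Rectifications of T[i+1, …, j] and the shapes they fill. -/

theorem StandardTableau.filling_ne_top {Y : YoungDiagram} (T : StandardTableau Y) (j : ℕ)
    (y : ℕ × ℕ) : T.filling j y ≠ ⊤ ↔ ∃ h : y ∈ Y.cells, T.entry ⟨y, h⟩ ≤ j := by
  unfold StandardTableau.filling
  split_ifs with h h' <;> simp_all

theorem StandardTableau.filling_succ {Y : YoungDiagram} (T : StandardTableau Y) {j : ℕ}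
    (hj : j < Y.card) : ∃ x ∈ Y.cells, T.filling j x = ⊤ ∧
      T.filling (j + 1) = Function.update (T.filling j) x ((j + 1 : ℕ) : WithTop ℕ) := by
  obtain ⟨x, -, hx⟩ := T.bijOn.surjOn (show j + 1 ∈ Set.Icc 1 Y.card from ⟨by omega, hj⟩)
  have hne : ∀ y : Y.cells, y ≠ x → T.entry y ≠ j + 1 := by
    intro y hy h
    exact hy (T.bijOn.injOn (Set.mem_univ y) (Set.mem_univ x) (h.trans hx.symm))
  refine ⟨x.1, x.2, ?_, ?_⟩
  · simp [StandardTableau.filling, hx]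
  · funext y
    by_cases hy : y = x.1
    · subst hy
      simp [StandardTableau.filling, hx]
    · rw [Function.update_of_ne hy]
      unfold StandardTableau.filling
      split_ifs with h h1 h2
      · rfl
      · exact absurd (show T.entry ⟨y, h⟩ = j + 1 by omega)
          (hne _ fun h' => hy (congrArg Subtype.val h'))
      · omega
      · rfl
      · rfl

theorem StandardTableau.rectification_succ {Y : YoungDiagram} (T : StandardTableau Y) (i j : ℕ) :
    T.rectification (i + 1) j = jdtSlide (Y.colLen 0 + Y.rowLen 0) (0, 0)
      (Function.update (T.rectification i j) (0, 0) ⊤) :=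
  Function.iterate_succ_apply' _ _ _

theorem StandardTableau.mem_subquotientShape {Y : YoungDiagram} (T : StandardTableau Y)
    (i j : ℕ) (y : ℕ × ℕ) :
    y ∈ (T.subquotientShape i j).cells ↔ y ∈ Y.cells ∧ T.rectification i j y ≠ ⊤ := by
  simp [StandardTableau.subquotientShape]

theorem StandardTableau.subquotientShape_zero {Y : YoungDiagram} (T : StandardTableau Y)
    (j : ℕ) : T.subquotientShape 0 j = T.subShape j := by
  ext y
  rw [T.mem_subquotientShape, show T.rectification 0 j = T.filling j from rfl, T.filling_ne_top]
  simp [StandardTableau.subShape]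

theorem StandardTableau.card_subShape {Y : YoungDiagram} (T : StandardTableau Y) {j : ℕ}
    (hj : j ≤ Y.card) : (T.subShape j).card = j := by
  have h1 : ((Finset.univ : Finset Y.cells).filter fun x => T.entry x ≤ j).image T.entry =
      Finset.Icc 1 j := by
    ext k
    simp only [Finset.mem_image, Finset.mem_filter, Finset.mem_univ, true_and, Finset.mem_Icc]
    constructor
    · rintro ⟨x, hx, rfl⟩
      exact ⟨(T.bijOn.mapsTo (Set.mem_univ x)).1, hx⟩
    · rintro ⟨h1, h2⟩
      obtain ⟨x, -, rfl⟩ := T.bijOn.surjOn (show k ∈ Set.Icc 1 Y.card from ⟨h1, h2.trans hj⟩)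
      exact ⟨x, h2, rfl⟩
  have h2 := Finset.card_image_of_injOn (s := (Finset.univ : Finset Y.cells).filter
    fun x => T.entry x ≤ j) (T.bijOn.injOn.mono (Set.subset_univ _))
  rw [h1, Nat.card_Icc] at h2
  have h3 : (T.subShape j).card =
      ((Finset.univ : Finset Y.cells).filter fun x => T.entry x ≤ j).card :=
    Finset.card_map _
  omega

/-- The rectifications of `T[i+1, …, j]` and `T[i+1, …, j+1]` differ by the box `x` of the largest
entry `j + 1`. -/
structure StandardTableau.RectificationInsert {Y : YoungDiagram} (T : StandardTableau Y)
    (i j : ℕ) (x : ℕ × ℕ) : Prop where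
  mem : x ∈ Y.cells
  mem_of_ne_top : ∀ y, T.rectification i j y ≠ ⊤ → y ∈ Y.cells
  lt : ∀ y, T.rectification i j y ≠ ⊤ → T.rectification i j y < ((j + 1 : ℕ) : WithTop ℕ)
  eq_top : T.rectification i j x = ⊤
  eq_update : T.rectification i (j + 1) =
    Function.update (T.rectification i j) x ((j + 1 : ℕ) : WithTop ℕ)

theorem StandardTableau.RectificationInsert.cells_eq {Y : YoungDiagram} {T : StandardTableau Y}
    {i j : ℕ} {x : ℕ × ℕ} (h : T.RectificationInsert i j x) :
    (T.subquotientShape i (j + 1)).cells = insert x (T.subquotientShape i j).cells := by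
  ext y
  rw [Finset.mem_insert, T.mem_subquotientShape, T.mem_subquotientShape, h.eq_update]
  by_cases hy : y = x
  · subst hy
    simp [h.mem]
  · simp [hy]

/-- One more round, by `jdtSlide_insert`: either `j + 1` stays in `x` and both tableaux lose the box
`e`, or `j + 1` moves from `x` to `e` and the larger tableau loses `x`. -/
theorem StandardTableau.RectificationInsert.succ {Y : YoungDiagram} {T : StandardTableau Y}
    {i j : ℕ} {x : ℕ × ℕ} (h : T.RectificationInsert i j x)
    (h0 : T.rectification i j (0, 0) ≠ ⊤) :
    ∃ e ∈ (T.subquotientShape i j).cells,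
      (T.subquotientShape (i + 1) j).cells = (T.subquotientShape i j).cells.erase e ∧
      ((T.RectificationInsert (i + 1) j x ∧ (T.subquotientShape (i + 1) (j + 1)).cells =
          (T.subquotientShape i (j + 1)).cells.erase e) ∨
        (T.RectificationInsert (i + 1) j e ∧ (x = (e.1, e.2 + 1) ∨ x = (e.1 + 1, e.2)) ∧
          (T.subquotientShape (i + 1) (j + 1)).cells =
            (T.subquotientShape i (j + 1)).cells.erase x)) := by
  have hlt : ∀ y ∈ Y.cells, y.1 + y.2 < Y.colLen 0 + Y.rowLen 0 := by
    intro y hy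
    have h1 : y.1 < Y.colLen 0 :=
      YoungDiagram.mem_iff_lt_colLen.1
        (Y.up_left_mem le_rfl (Nat.zero_le y.2) (show (y.1, y.2) ∈ Y from hy))
    have h2 : y.2 < Y.rowLen 0 :=
      YoungDiagram.mem_iff_lt_rowLen.1
        (Y.up_left_mem (Nat.zero_le y.1) le_rfl (show (y.1, y.2) ∈ Y from hy))
    omega
  have hx0 : x ≠ (0, 0) := by rintro rfl; exact h0 h.eq_top
  have hupd : ∀ y, Function.update (T.rectification i j) (0, 0) ⊤ y =
      if y = (0, 0) then ⊤ else T.rectification i j y := fun y => by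
    rw [Function.update_apply]
  obtain ⟨h1, e, he, h2, h3⟩ := jdtSlide_insert (Y.colLen 0 + Y.rowLen 0)
    ((j + 1 : ℕ) : WithTop ℕ) (WithTop.natCast_ne_top _) x (hlt x h.mem)
    (Y.colLen 0 + Y.rowLen 0) (0, 0) (Function.update (T.rectification i j) (0, 0) ⊤) (by simp)
    (by
      intro y hy
      rw [hupd]
      split_ifs with h'
      · rfl
      · by_contra hne
        have := hlt y (h.mem_of_ne_top y hne)
        omega)
    (by simp)
    (by
      intro y hy
      rw [hupd]
      split_ifs with h'
      · rfl
      · have := T.rectification_mono i j hy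
        rw [h.eq_top] at this
        exact top_le_iff.1 this)
    hx0
    (by
      intro y
      rw [hupd]
      split_ifs with h'
      · simp
      · exact h.lt y)
  rw [Function.update_comm hx0.symm, ← h.eq_update, ← T.rectification_succ,
    ← T.rectification_succ] at h3
  rw [← T.rectification_succ] at h1 h2
  have hs : ∀ y, T.rectification (i + 1) j y ≠ ⊤ ↔ T.rectification i j y ≠ ⊤ ∧ y ≠ e := by
    intro y
    rw [h2, hupd]
    by_cases hy : y = (0, 0)
    · subst hy
      simp [h0]
    · simp [hy]
  have he' : T.rectification i j e ≠ ⊤ := by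
    rw [hupd] at he
    split_ifs at he with h'
    · rw [h']; exact h0
    · exact he.resolve_left h'
  have heY : e ∈ Y.cells := h.mem_of_ne_top e he'
  have hxe : x ≠ e := by rintro rfl; exact he' h.eq_top
  have hmem : ∀ y, T.rectification (i + 1) j y ≠ ⊤ → y ∈ Y.cells := fun y hy =>
    h.mem_of_ne_top y ((hs y).1 hy).1
  have htop : ∀ y, (y = x ∨ y = e) → T.rectification (i + 1) j y = ⊤ := by
    intro y hy
    by_contra hne
    rcases hy with rfl | rfl
    · exact ((hs y).1 hne).1 h.eq_top
    · exact ((hs y).1 hne).2 rfl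
  have hcells : (T.subquotientShape (i + 1) j).cells =
      (T.subquotientShape i j).cells.erase e := by
    ext y
    rw [Finset.mem_erase, T.mem_subquotientShape, T.mem_subquotientShape, hs]
    tauto
  have hxS : x ∉ (T.subquotientShape i j).cells := fun hx =>
    ((T.mem_subquotientShape i j x).1 hx).2 h.eq_top
  have heS : e ∈ (T.subquotientShape i j).cells := (T.mem_subquotientShape i j e).2 ⟨heY, he'⟩
  refine ⟨e, heS, hcells, ?_⟩
  rcases h3 with h3 | ⟨hadj, h3⟩
  · have hI : T.RectificationInsert (i + 1) j x :=
      ⟨h.mem, hmem, h1, htop x (Or.inl rfl), h3⟩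
    refine Or.inl ⟨hI, ?_⟩
    rw [hI.cells_eq, h.cells_eq, hcells, Finset.erase_insert_of_ne hxe]
  · have hI : T.RectificationInsert (i + 1) j e :=
      ⟨heY, hmem, h1, htop e (Or.inr rfl), h3⟩
    refine Or.inr ⟨hI, hadj, ?_⟩
    rw [hI.cells_eq, h.cells_eq, hcells, Finset.insert_erase heS, Finset.erase_insert hxS]

theorem StandardTableau.rectification_zero_ne_top {Y : YoungDiagram} (T : StandardTableau Y)
    {i j : ℕ} (h : 0 < (T.subquotientShape i j).card) : T.rectification i j (0, 0) ≠ ⊤ := by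
  obtain ⟨y, hy⟩ := Finset.card_pos.1 h
  exact ((T.mem_subquotientShape i j _).1 ((T.subquotientShape i j).isLowerSet
    (show ((0, 0) : ℕ × ℕ) ≤ y from ⟨Nat.zero_le _, Nat.zero_le _⟩) hy)).2

/-- The size and the box must be carried through the induction together: the size keeps the corner
occupied before each removal, as `RectificationInsert.succ` requires. -/
theorem StandardTableau.exists_rectificationInsert {Y : YoungDiagram} (T : StandardTableau Y)
    {j : ℕ} (hj : j < Y.card) : ∀ i ≤ j, (T.subquotientShape i j).card = j - i ∧
      ∃ x, T.RectificationInsert i j x := by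
  intro i
  induction i with
  | zero =>
    intro _
    refine ⟨by rw [T.subquotientShape_zero, T.card_subShape hj.le]; rfl, ?_⟩
    obtain ⟨x, hx, h1, h2⟩ := T.filling_succ hj
    refine ⟨x, hx, ?_, ?_, h1, h2⟩
    · intro y hy
      exact ((T.filling_ne_top j y).1 hy).1
    · intro y hy
      change T.filling j y < _
      obtain ⟨h3, h4⟩ := (T.filling_ne_top j y).1 hy
      simp only [StandardTableau.filling, h3, h4, if_true, dif_pos]
      exact_mod_cast Nat.lt_succ_of_le h4
  | succ i ih =>
    intro hi
    obtain ⟨hc, x, hx⟩ := ih (by omega)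
    have h0 := T.rectification_zero_ne_top (i := i) (j := j) (by omega)
    obtain ⟨e, he, h1, h2⟩ := hx.succ h0
    constructor
    · change (T.subquotientShape (i + 1) j).cells.card = _
      rw [h1, Finset.card_erase_of_mem he]
      change (T.subquotientShape i j).card - 1 = _
      omega
    · rcases h2 with h2 | h2
      · exact ⟨x, h2.1⟩
      · exact ⟨e, h2.1⟩

theorem StandardTableau.subquotientShape_self {Y : YoungDiagram} (T : StandardTableau Y)
    {i : ℕ} (hi : i < Y.card) : (T.subquotientShape i i).cells = ∅ := by
  have := (T.exists_rectificationInsert hi i le_rfl).1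
  rw [Nat.sub_self] at this
  exact Finset.card_eq_zero.1 this

/-- The local rule of jeu de taquin for the shapes of the rectifications. -/
theorem StandardTableau.subquotientShape_local_rule {Y : YoungDiagram} (T : StandardTableau Y)
    {i j : ℕ} (hij : i < j) (hj : j < Y.card) :
    ∃ x e : ℕ × ℕ, x ∉ (T.subquotientShape i j).cells ∧
      (T.subquotientShape i (j + 1)).cells = insert x (T.subquotientShape i j).cells ∧
      e ∈ (T.subquotientShape i j).cells ∧
      (T.subquotientShape (i + 1) j).cells = (T.subquotientShape i j).cells.erase e ∧
      ((T.subquotientShape (i + 1) (j + 1)).cells =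
          (T.subquotientShape i (j + 1)).cells.erase e ∨
        ((x = (e.1, e.2 + 1) ∨ x = (e.1 + 1, e.2)) ∧
          (T.subquotientShape (i + 1) (j + 1)).cells =
            (T.subquotientShape i (j + 1)).cells.erase x)) := by
  obtain ⟨hc, x, hx⟩ := T.exists_rectificationInsert hj i hij.le
  have h0 := T.rectification_zero_ne_top (i := i) (j := j) (by omega)
  obtain ⟨e, he, h1, h2⟩ := hx.succ h0
  refine ⟨x, e, fun h => ((T.mem_subquotientShape i j x).1 h).2 hx.eq_top, hx.cells_eq, he, h1, ?_⟩
  rcases h2 with h2 | h2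
  · exact Or.inl h2.2
  · exact Or.inr h2.2

/-! ### Numbers of boxes to the right of a column -/

/-- The number of boxes of `μ` in the columns `k, k + 1, …`. -/
def YoungDiagram.cardFromCol (μ : YoungDiagram) (k : ℕ) : ℕ :=
  (μ.cells.filter fun x => k ≤ x.2).card

theorem YoungDiagram.cardFromCol_eq_add (μ : YoungDiagram) (k : ℕ) :
    μ.cardFromCol k = μ.cardFromCol (k + 1) + μ.colLen k := by
  have h : μ.cells.filter (fun x => k ≤ x.2) =
      μ.cells.filter (fun x => k + 1 ≤ x.2) ∪ μ.col k := by
    ext x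
    rw [Finset.mem_union, YoungDiagram.mem_col_iff]
    simp only [Finset.mem_filter, YoungDiagram.mem_cells]
    constructor
    · rintro ⟨h1, h2⟩
      rcases h2.lt_or_eq with h | h
      · exact Or.inl ⟨h1, h⟩
      · exact Or.inr ⟨h1, h.symm⟩
    · rintro (⟨h1, h2⟩ | ⟨h1, h2⟩)
      · exact ⟨h1, by omega⟩
      · exact ⟨h1, h2.ge⟩
  rw [YoungDiagram.colLen_eq_card, YoungDiagram.cardFromCol, h, Finset.card_union_of_disjoint]
  · rfl
  · rw [Finset.disjoint_left]
    intro x h1 h2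
    rw [YoungDiagram.mem_col_iff] at h2
    have := (Finset.mem_filter.1 h1).2
    omega

theorem YoungDiagram.cardFromCol_of_cells_eq_insert {μ l : YoungDiagram} {x : ℕ × ℕ}
    (hx : x ∉ μ.cells) (h : l.cells = insert x μ.cells) (k : ℕ) :
    l.cardFromCol k = μ.cardFromCol k + if k ≤ x.2 then 1 else 0 := by
  unfold YoungDiagram.cardFromCol
  rw [h, Finset.filter_insert]
  split_ifs with hk
  · rw [Finset.card_insert_of_notMem (by simp [hx])]
  · rfl

theorem YoungDiagram.cardFromCol_of_cells_eq_erase {μ l : YoungDiagram} {x : ℕ × ℕ}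
    (hx : x ∈ μ.cells) (h : l.cells = μ.cells.erase x) (k : ℕ) :
    μ.cardFromCol k = l.cardFromCol k + if k ≤ x.2 then 1 else 0 := by
  refine YoungDiagram.cardFromCol_of_cells_eq_insert (x := x) ?_ ?_ k
  · rw [h]; simp
  · rw [h, Finset.insert_erase hx]

/-! ### Ranks of powers on subquotients -/

section LinearAlgebra

variable {K V : Type*} [Field K] [AddCommGroup V] [Module K V]

theorem map_map_pow_sup (u : Module.End K V) {A : Submodule K V} (hA : ∀ v ∈ A, u v ∈ A)
    (W : Submodule K V) (k : ℕ) :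
    (W.map (u ^ k) ⊔ A).map u ⊔ A = W.map (u ^ (k + 1)) ⊔ A := by
  have h : A.map u ≤ A := by
    rintro _ ⟨v, hv, rfl⟩
    exact hA v hv
  rw [Submodule.map_sup, sup_assoc, sup_eq_right.2 h, pow_succ', Module.End.mul_eq_comp,
    Submodule.map_comp]

theorem map_pow_antitone (u : Module.End K V) {W : Submodule K V} (hW : ∀ v ∈ W, u v ∈ W) :
    Antitone fun k => W.map (u ^ k) := by
  refine antitone_nat_of_succ_le fun k => ?_
  rintro _ ⟨v, hv, rfl⟩
  exact ⟨u v, hW v hv, by rw [pow_succ]; rfl⟩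

/-- On `H` the powers of `u` commute with `g` up to an error in `A`, which is absorbed because `g`
fixes `A` pointwise and `A ≤ B`. -/
theorem map_pow_map_sup_map {u : Module.End K V} {A H B S : Submodule K V} (g : V ≃ₗ[K] V)
    (hA : ∀ v ∈ A, u v ∈ A) (hH : ∀ v ∈ H, u v ∈ H) (hgA : ∀ v ∈ A, g v = v)
    (hgH : ∀ v ∈ H, u (g v) - g (u v) ∈ A) (hAB : A ≤ B) (hSH : S ≤ H) (k : ℕ) :
    (S.map (g : V →ₗ[K] V)).map (u ^ k) ⊔ B.map (g : V →ₗ[K] V) =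
      (S.map (u ^ k) ⊔ B).map (g : V →ₗ[K] V) := by
  have hpow : ∀ k, ∀ v ∈ H, (u ^ k) v ∈ H ∧ (u ^ k) (g v) - g ((u ^ k) v) ∈ A := by
    intro k
    induction k with
    | zero => intro v hv; simp [hv]
    | succ k ih =>
      intro v hv
      obtain ⟨h1, h2⟩ := ih v hv
      rw [pow_succ']
      refine ⟨hH _ h1, ?_⟩
      have h3 := A.add_mem (hA _ h2) (hgH _ h1)
      rw [map_sub] at h3
      simpa using h3
  have hgB : ∀ a ∈ A, a ∈ B.map (g : V →ₗ[K] V) := fun a ha => ⟨a, hAB ha, hgA a ha⟩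
  rw [Submodule.map_sup]
  apply le_antisymm
  · refine sup_le ?_ le_sup_right
    rintro _ ⟨_, ⟨v, hv, rfl⟩, rfl⟩
    have h1 := hgB _ (hpow k v (hSH hv)).2
    have h2 : (u ^ k) (g v) = g ((u ^ k) v) + ((u ^ k) (g v) - g ((u ^ k) v)) := by abel
    change (u ^ k) (g v) ∈ _
    rw [h2]
    exact Submodule.add_mem_sup ⟨_, ⟨v, hv, rfl⟩, rfl⟩ h1
  · refine sup_le ?_ le_sup_right
    rintro _ ⟨_, ⟨v, hv, rfl⟩, rfl⟩
    have h1 := hgB _ (hpow k v (hSH hv)).2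
    have h2 : g ((u ^ k) v) = (u ^ k) (g v) - ((u ^ k) (g v) - g ((u ^ k) v)) := by abel
    change g ((u ^ k) v) ∈ _
    rw [h2]
    exact Submodule.sub_mem _ (Submodule.mem_sup_left ⟨_, ⟨v, hv, rfl⟩, rfl⟩)
      (Submodule.mem_sup_right h1)

/-- For stable subspaces `A ⊆ W`, the map induced by a nilpotent `u` on `W / A` has Jordan type `l`,
expressed by the ranks of its powers. -/
def HasSubquotientType (u : Module.End K V) (A W : Submodule K V) (l : YoungDiagram) : Prop :=
  ∀ k, Module.finrank K ↥(W.map (u ^ k) ⊔ A) = Module.finrank K A + l.cardFromCol k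

theorem HasSubquotientType.map {u : Module.End K V} {A H B S : Submodule K V} {l : YoungDiagram}
    (h : HasSubquotientType u B S l) (g : V ≃ₗ[K] V)
    (hA : ∀ v ∈ A, u v ∈ A) (hH : ∀ v ∈ H, u v ∈ H) (hgA : ∀ v ∈ A, g v = v)
    (hgH : ∀ v ∈ H, u (g v) - g (u v) ∈ A) (hAB : A ≤ B) (hSH : S ≤ H) :
    HasSubquotientType u (B.map (g : V →ₗ[K] V)) (S.map (g : V →ₗ[K] V)) l := by
  intro k
  rw [map_pow_map_sup_map g hA hH hgA hgH hAB hSH, LinearEquiv.finrank_map_eq,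
    LinearEquiv.finrank_map_eq, h k]

/-- Modulo `A`, a vector `v ∈ ker u` outside `u ^ (c + 1) H` is sent to any given vector
`u ^ c m ∈ ker u` with `m ∈ H` by an endomorphism that commutes with `u` on `H / A`. -/
theorem exists_commuting_endomorphism (u : Module.End K V) {A H : Submodule K V}
    (hA : ∀ v ∈ A, u v ∈ A) (hH : ∀ v ∈ H, u v ∈ H) {c : ℕ} {m v : V} (hm : m ∈ H)
    (hcm : (u ^ (c + 1)) m ∈ A) (hv : v ∉ H.map (u ^ (c + 1)) ⊔ A) (huv : u v ∈ A) :
    ∃ h : Module.End K V, (∀ a ∈ A, h a = 0) ∧ (∀ w, h w ∈ H) ∧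
      (∀ w ∈ H, u (h w) - h (u w) ∈ A) ∧ h v = (u ^ c) m := by
  obtain ⟨φ, hφv, hφ⟩ := Submodule.exists_le_ker_of_notMem hv
  have hpowA : ∀ k, ∀ a ∈ A, (u ^ k) a ∈ A := by
    intro k
    induction k with
    | zero => intro a ha; simpa using ha
    | succ k ih => intro a ha; rw [pow_succ]; exact ih _ (hA a ha)
  have hpowH : ∀ k, (u ^ k) m ∈ H := by
    intro k
    induction k with
    | zero => simpa using hm
    | succ k ih => rw [pow_succ']; exact hH _ ih
  have hφA : ∀ a ∈ A, φ a = 0 := fun a ha => hφ (Submodule.mem_sup_right ha)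
  -- In the commutator of `u` with this sum everything telescopes except two end terms: one lies in
  -- `A` since u^(c+1) m does, the other vanishes on `H` since `φ` kills u^(c+1) H. At `v` only s =
  -- c survives, because `u v ∈ A`.
  let h : Module.End K V := (φ v)⁻¹ • ∑ s ∈ Finset.range (c + 1),
    (φ ∘ₗ (u ^ (c - s))).smulRight ((u ^ s) m)
  have hval : ∀ w, h w = (φ v)⁻¹ • ∑ s ∈ Finset.range (c + 1),
      φ ((u ^ (c - s)) w) • (u ^ s) m := by
    intro w
    simp [h, LinearMap.sum_apply]
  refine ⟨h, ?_, ?_, ?_, ?_⟩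
  · intro a ha
    rw [hval, Finset.sum_eq_zero, smul_zero]
    intro s _
    rw [hφA _ (hpowA _ a ha), zero_smul]
  · intro w
    rw [hval]
    exact H.smul_mem _ (H.sum_mem fun s _ => H.smul_mem _ (hpowH s))
  · intro w hw
    have h1 : u (h w) - h (u w) = (φ v)⁻¹ • (φ w • (u ^ (c + 1)) m -
        φ ((u ^ (c + 1)) w) • m) := by
      rw [hval, hval, map_smul, map_sum, ← smul_sub, Finset.sum_range_succ,
        Finset.sum_range_succ']
      have h2 : ∑ s ∈ Finset.range c, u (φ ((u ^ (c - s)) w) • (u ^ s) m) =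
          ∑ s ∈ Finset.range c, φ ((u ^ (c - (s + 1))) (u w)) • (u ^ (s + 1)) m := by
        refine Finset.sum_congr rfl fun s hs => ?_
        have h3 : c - s = c - (s + 1) + 1 := by
          have := Finset.mem_range.1 hs
          omega
        rw [map_smul, h3, pow_succ, pow_succ']
        rfl
      have h4 : (u ^ (c + 1)) m = u ((u ^ c) m) := by rw [pow_succ']; rfl
      have h5 : (u ^ (c + 1)) w = (u ^ c) (u w) := by rw [pow_succ]; rfl
      rw [h2, map_smul, Nat.sub_self, Nat.sub_zero, h4, h5]
      simp only [pow_zero, Module.End.one_apply]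
      congr 1
      abel
    rw [h1, show φ ((u ^ (c + 1)) w) = 0 from hφ (Submodule.mem_sup_left ⟨w, hw, rfl⟩), zero_smul,
      sub_zero]
    exact A.smul_mem _ (A.smul_mem _ hcm)
  · rw [hval, Finset.sum_range_succ, Finset.sum_eq_zero]
    · simp [smul_smul, inv_mul_cancel₀ hφv]
    · intro s hs
      have h3 : c - s = c - (s + 1) + 1 := by
        have := Finset.mem_range.1 hs
        omega
      rw [h3, pow_succ, Module.End.mul_apply, hφA _ (hpowA _ _ huv), zero_smul]

/-! ### Dimension counts, and quotients by a line. -/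

variable [FiniteDimensional K V]

/-- Rank–nullity for the map S → V / A induced by `u`. -/
theorem finrank_inf_comap_add (u : Module.End K V) (S A : Submodule K V) :
    Module.finrank K ↥(S ⊓ A.comap u) + Module.finrank K ↥(S.map u ⊔ A) =
      Module.finrank K S + Module.finrank K A := by
  have h1 := ((A.mkQ ∘ₗ u).domRestrict S).finrank_range_add_finrank_ker
  have h2 : ((A.mkQ ∘ₗ u).domRestrict S).ker = (S ⊓ A.comap u).submoduleOf S := by
    ext x
    simp [Submodule.submoduleOf]
  have h3 : ((A.mkQ ∘ₗ u).domRestrict S).range = (S.map u ⊔ A).map A.mkQ := by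
    rw [Submodule.map_sup, LinearMap.range_domRestrict, Submodule.map_comp]
    have : A.map A.mkQ = ⊥ := by simp
    rw [this, sup_bot_eq]
  have h4 := (A.mkQ.domRestrict (S.map u ⊔ A)).finrank_range_add_finrank_ker
  have h5 : (A.mkQ.domRestrict (S.map u ⊔ A)).ker = A.submoduleOf (S.map u ⊔ A) := by
    ext x
    simp [Submodule.submoduleOf]
  rw [LinearMap.range_domRestrict, h5,
    (Submodule.submoduleOfEquivOfLe (le_sup_right : A ≤ S.map u ⊔ A)).finrank_eq] at h4
  rw [h3, h2, (Submodule.submoduleOfEquivOfLe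
    (inf_le_left : S ⊓ A.comap u ≤ S)).finrank_eq] at h1
  omega

theorem finrank_sup_span_singleton (S : Submodule K V) (v : V) [Decidable (v ∈ S)] :
    Module.finrank K ↥(S ⊔ K ∙ v) = Module.finrank K S + if v ∈ S then 0 else 1 := by
  split_ifs with h
  · rw [sup_eq_left.2 ((Submodule.span_singleton_le_iff_mem _ _).2 h), add_zero]
  · have hv : v ≠ 0 := by rintro rfl; exact h S.zero_mem
    have h1 := Submodule.finrank_sup_add_finrank_inf_eq S (K ∙ v)
    have h2 : S ⊓ (K ∙ v) = ⊥ := by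
      rw [← disjoint_iff]
      exact (Submodule.disjoint_span_singleton' hv).2 h
    rw [h2, finrank_bot, finrank_span_singleton hv] at h1
    omega

/-- On W / A, ker u ∩ im u^k has as dimension the number of Jordan blocks longer than k, the height
of column k. -/
theorem HasSubquotientType.finrank_inf_comap {u : Module.End K V} {A W : Submodule K V}
    {l : YoungDiagram} (h : HasSubquotientType u A W l) (hA : ∀ v ∈ A, u v ∈ A) (k : ℕ) :
    Module.finrank K ↥((W.map (u ^ k) ⊔ A) ⊓ A.comap u) = Module.finrank K A + l.colLen k := by
  have h1 := finrank_inf_comap_add u (W.map (u ^ k) ⊔ A) A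
  rw [map_map_pow_sup u hA, h k, h (k + 1), l.cardFromCol_eq_add k] at h1
  omega

/-- Dividing by the line of `v` lowers the rank of u^k exactly when `v` lies in im u^k modulo `A`.
So the depth of `v` in the filtration by images is the column of the removed box; `mem_iff` is the
converse. -/
theorem HasSubquotientType.sup_span_singleton {u : Module.End K V} {A W : Submodule K V}
    {l l' : YoungDiagram} (h : HasSubquotientType u A W l) {v : V} (hv : v ∉ A) {y : ℕ × ℕ}
    (hy : y ∈ l.cells) (hl : l'.cells = l.cells.erase y)
    (hmem : ∀ k, v ∈ W.map (u ^ k) ⊔ A ↔ k ≤ y.2) :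
    HasSubquotientType u (A ⊔ K ∙ v) W l' := by
  classical
  intro k
  rw [← sup_assoc, finrank_sup_span_singleton, finrank_sup_span_singleton, if_neg hv, h k,
    YoungDiagram.cardFromCol_of_cells_eq_erase hy hl k]
  simp only [hmem]
  split_ifs <;> omega

theorem HasSubquotientType.mem_iff {u : Module.End K V} {A W : Submodule K V}
    {l l' : YoungDiagram} (h : HasSubquotientType u A W l) {v : V} (hv : v ∉ A) {y : ℕ × ℕ}
    (hy : y ∈ l.cells) (hl : l'.cells = l.cells.erase y)
    (h' : HasSubquotientType u (A ⊔ K ∙ v) W l') (k : ℕ) :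
    v ∈ W.map (u ^ k) ⊔ A ↔ k ≤ y.2 := by
  classical
  have h1 := h' k
  rw [← sup_assoc, finrank_sup_span_singleton, finrank_sup_span_singleton, if_neg hv, h k,
    YoungDiagram.cardFromCol_of_cells_eq_erase hy hl k] at h1
  split_ifs at h1 with h2 h3 h3
  · simp [h2, h3]
  · omega
  · omega
  · simp [h2, h3]

/-- The types of `H / L` and `W / A` determine that of `W / L`, where `L = A + ⟨v⟩`, unless a
generic choice of `L` would give a different type. -/
theorem HasSubquotientType.step {u : Module.End K V} {A H W : Submodule K V}
    {μ l ν l' : YoungDiagram} {v : V} {x e : ℕ × ℕ}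
    (hA : ∀ v ∈ A, u v ∈ A) (hH : ∀ v ∈ H, u v ∈ H) (hW : ∀ v ∈ W, u v ∈ W)
    (hHW : H ≤ W) (hv : v ∉ A) (huv : u v ∈ A)
    (h1 : HasSubquotientType u A H μ) (h2 : HasSubquotientType u A W l)
    (h3 : HasSubquotientType u (A ⊔ K ∙ v) H ν)
    (hx : x ∉ μ.cells) (hl : l.cells = insert x μ.cells)
    (he : e ∈ μ.cells) (hν : ν.cells = μ.cells.erase e)
    (hl' : l'.cells = l.cells.erase e ∨
      ((x = (e.1, e.2 + 1) ∨ x = (e.1 + 1, e.2)) ∧ l'.cells = l.cells.erase x)) :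
    HasSubquotientType u (A ⊔ K ∙ v) W l' ∨
      ∃ c : ℕ, ∃ m ∈ H, (u ^ (c + 1)) m ∈ A ∧ (u ^ c) m ∉ W.map (u ^ (c + 1)) ⊔ A ∧
        v ∈ H.map (u ^ c) ⊔ A ∧ v ∉ H.map (u ^ (c + 1)) ⊔ A ∧
        v ∈ W.map (u ^ (c + 1)) ⊔ A ∧
        ∀ w ∉ A, w ∈ H.map (u ^ c) ⊔ A → w ∉ W.map (u ^ (c + 1)) ⊔ A →
          HasSubquotientType u (A ⊔ K ∙ w) W l' := by
  have hmem := h1.mem_iff hv he hν h3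
  have hle : ∀ k, H.map (u ^ k) ⊔ A ≤ W.map (u ^ k) ⊔ A := fun k =>
    sup_le_sup_right (Submodule.map_mono hHW) _
  have hanti : ∀ {k k' : ℕ}, k ≤ k' → W.map (u ^ k') ⊔ A ≤ W.map (u ^ k) ⊔ A := fun hk =>
    sup_le_sup_right (map_pow_antitone u hW hk) _
  have hantiH : ∀ {k k' : ℕ}, k ≤ k' → H.map (u ^ k') ⊔ A ≤ H.map (u ^ k) ⊔ A := fun hk =>
    sup_le_sup_right (map_pow_antitone u hH hk) _
  have hr := YoungDiagram.cardFromCol_of_cells_eq_insert hx hl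
  have hfar : ∀ k, x.2 < k → H.map (u ^ k) ⊔ A = W.map (u ^ k) ⊔ A := by
    intro k hk
    refine Submodule.eq_of_le_of_finrank_eq (hle k) ?_
    rw [h1 k, h2 k, hr, if_neg (by omega), add_zero]
  have hel : e ∈ l.cells := by rw [hl]; exact Finset.mem_insert_of_mem he
  have hxl : x ∈ l.cells := by rw [hl]; exact Finset.mem_insert_self _ _
  have hxe : x ≠ e := by rintro rfl; exact hx he
  -- The depth of `v` in H / A is `e.2`, and its depth in W / A can be larger only if `x` is
  -- strictly to the right of `e`. Otherwise both alternatives of the local rule remove a box of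
  -- column `e.2`.
  by_cases hxc : x.2 ≤ e.2
  · have hmem' : ∀ k, v ∈ W.map (u ^ k) ⊔ A ↔ k ≤ e.2 := by
      intro k
      rcases le_or_gt k e.2 with hk | hk
      · exact ⟨fun _ => hk, fun _ => hle k ((hmem k).2 hk)⟩
      · rw [← hfar k (by omega), hmem]
    left
    rcases hl' with hl' | ⟨rfl | hx', hl'⟩
    · exact h2.sup_span_singleton hv hel hl' hmem'
    · simp at hxc
    · refine h2.sup_span_singleton hv hxl hl' ?_
      rw [hx']
      exact hmem'
  · rw [not_le] at hxc
    rcases hl' with hl' | ⟨hx' | hx', hl'⟩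
    · have hgood : ∀ w ∉ A, w ∈ H.map (u ^ e.2) ⊔ A → w ∉ W.map (u ^ (e.2 + 1)) ⊔ A →
          HasSubquotientType u (A ⊔ K ∙ w) W l' := by
        intro w hw hw1 hw2
        refine h2.sup_span_singleton hw hel hl' fun k => ?_
        constructor
        · intro hk
          by_contra hlt
          exact hw2 (hanti (by omega) hk)
        · intro hk
          exact hanti hk (hle _ hw1)
      by_cases hvD : v ∈ W.map (u ^ (e.2 + 1)) ⊔ A
      · right
        -- The right neighbour of `e` is not in `l`, else it would survive in `l'` without `e`.
        -- Hence ker u ∩ im u^(e.2) on H / A is too large to lie in im u^(e.2 + 1) on W / A, and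
        -- this supplies `m`.
        have hcol : l.colLen (e.2 + 1) < μ.colLen e.2 := by
          have h4 : e.1 < μ.colLen e.2 := YoungDiagram.mem_iff_lt_colLen.1 he
          have h5 : ¬ e.1 < l.colLen (e.2 + 1) := by
            rw [← YoungDiagram.mem_iff_lt_colLen]
            intro h
            have h6 : (e.1, e.2 + 1) ∈ l'.cells := by
              rw [hl', Finset.mem_erase]
              exact ⟨fun h' => by simpa using congrArg Prod.snd h', h⟩
            have h7 : e ∈ l'.cells := l'.isLowerSet
              (show e ≤ (e.1, e.2 + 1) from ⟨le_rfl, Nat.le_succ _⟩) h6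
            rw [hl'] at h7
            simp at h7
          omega
        have hnot : ¬ (H.map (u ^ e.2) ⊔ A) ⊓ A.comap u ≤
            (W.map (u ^ (e.2 + 1)) ⊔ A) ⊓ A.comap u := by
          intro hle'
          have := Submodule.finrank_mono hle'
          rw [h1.finrank_inf_comap hA, h2.finrank_inf_comap hA] at this
          omega
        obtain ⟨w, ⟨hw1, hw2⟩, hw3⟩ := Set.not_subset.1 hnot
        obtain ⟨_, ⟨m, hm, rfl⟩, a, ha, rfl⟩ := Submodule.mem_sup.1 hw1
        refine ⟨e.2, m, hm, ?_, ?_, (hmem _).2 le_rfl, ?_, hvD, hgood⟩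
        · have := A.sub_mem hw2 (hA a ha)
          rw [map_add, add_sub_cancel_right] at this
          rw [pow_succ']
          exact this
        · intro h
          exact hw3 ⟨add_mem h (Submodule.mem_sup_right ha), hw2⟩
        · rw [hmem]
          omega
      · exact Or.inl (hgood v hv ((hmem _).2 le_rfl) hvD)
    · left
      refine h2.sup_span_singleton hv hxl hl' fun k => ?_
      -- Equal columns mean that ker u meets im u^(e.2) and im u^(e.2 + 1) on W / A in the same
      -- space, so `v` automatically has the depth `x.2`.
      have hcol : l.colLen e.2 = l.colLen (e.2 + 1) := by
        have h4 : e.1 < l.colLen (e.2 + 1) := by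
          rw [← YoungDiagram.mem_iff_lt_colLen]
          rw [hx'] at hxl
          exact hxl
        have h5 : ¬ e.1 + 1 < l.colLen e.2 := by
          rw [← YoungDiagram.mem_iff_lt_colLen]
          intro h
          have h6 : (e.1 + 1, e.2) ∈ ν.cells := by
            rw [hν, Finset.mem_erase]
            refine ⟨fun h' => by simpa using congrArg Prod.fst h', ?_⟩
            have h7 : (e.1 + 1, e.2) ∈ l.cells := h
            rw [hl, Finset.mem_insert] at h7
            refine h7.resolve_left fun h' => ?_
            rw [hx'] at h'
            simp at h'
          have h7 : e ∈ ν.cells := ν.isLowerSet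
            (show e ≤ (e.1 + 1, e.2) from ⟨Nat.le_succ _, le_rfl⟩) h6
          rw [hν] at h7
          simp at h7
        have h6 := l.colLen_anti e.2 (e.2 + 1) (Nat.le_succ _)
        omega
      have heq : (W.map (u ^ (e.2 + 1)) ⊔ A) ⊓ A.comap u =
          (W.map (u ^ e.2) ⊔ A) ⊓ A.comap u := by
        refine Submodule.eq_of_le_of_finrank_eq (inf_le_inf_right _ (hanti (Nat.le_succ _))) ?_
        rw [h2.finrank_inf_comap hA, h2.finrank_inf_comap hA, hcol]
      have hvD : v ∈ W.map (u ^ (e.2 + 1)) ⊔ A := by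
        have : v ∈ (W.map (u ^ e.2) ⊔ A) ⊓ A.comap u := ⟨hle _ ((hmem _).2 le_rfl), huv⟩
        rw [← heq] at this
        exact this.1
      have hx2 : x.2 = e.2 + 1 := by rw [hx']
      rcases le_or_gt k x.2 with hk | hk
      · exact ⟨fun _ => hk, fun _ => hanti (by omega) hvD⟩
      · rw [← hfar k hk, hmem]
        omega
    · rw [hx'] at hxc
      simp at hxc

/-- For t ≠ 0, 1 + t h fails to be invertible only if -1/t is one of the finitely many eigenvalues
of `h`. -/
theorem exists_linearEquiv_add_smul (h : Module.End K V) [Infinite K] :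
    {t : K | t ≠ 0 ∧ ∃ g : V ≃ₗ[K] V, ∀ v, g v = v + t • h v}.Infinite := by
  have hfin : (Inv.inv ∘ Neg.neg ⁻¹' {μ : K | h.HasEigenvalue μ} ∪ {0}).Finite := by
    refine Set.Finite.union (Set.Finite.preimage ?_ (Module.End.finite_hasEigenvalue h))
      (Set.finite_singleton 0)
    exact (inv_injective.comp neg_injective).injOn
  refine hfin.infinite_compl.mono fun t ht => ?_
  simp only [Set.mem_compl_iff, Set.mem_union, Set.mem_preimage, Set.mem_singleton_iff, not_or,
    Function.comp_apply] at ht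
  obtain ⟨h1, h2⟩ := ht
  refine ⟨h2, LinearEquiv.ofInjectiveEndo (1 + t • h) ?_, ?_⟩
  · rw [← LinearMap.ker_eq_bot, LinearMap.ker_eq_bot']
    intro v hv
    by_contra hne
    refine h1 (Module.End.hasEigenvalue_of_hasEigenvector (x := v) ⟨?_, hne⟩)
    rw [Module.End.mem_eigenspace_iff]
    have h3 : v = -(t • h v) := eq_neg_of_add_eq_zero_left hv
    nth_rewrite 2 [h3]
    rw [smul_neg, smul_smul, inv_neg, neg_mul, inv_mul_cancel₀ h2]
    simp
  · intro v
    simp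

end LinearAlgebra

/-! ### Flags and Zariski closed sets -/

namespace CompleteFlag

variable {n : ℕ}

/-- The member `V_k` of a flag, for a natural number `k` (it is `V_n` for `k ≥ n`). -/
def sp (F : CompleteFlag n) (k : ℕ) : Submodule ℂ (Fin n → ℂ) :=
  F.space ⟨min k n, Nat.lt_succ_of_le (min_le_right k n)⟩

theorem sp_val (F : CompleteFlag n) (i : Fin (n + 1)) : F.sp i = F.space i :=
  congrArg F.space (Fin.ext (min_eq_left (Nat.lt_succ_iff.1 i.2)))

theorem sp_mono (F : CompleteFlag n) {i j : ℕ} (h : i ≤ j) : F.sp i ≤ F.sp j :=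
  F.mono (Fin.mk_le_mk.2 (min_le_min_right n h))

theorem finrank_sp (F : CompleteFlag n) {k : ℕ} (h : k ≤ n) : Module.finrank ℂ (F.sp k) = k :=
  (F.finrank_eq _).trans (min_eq_left h)

theorem ext_sp {F G : CompleteFlag n} (h : ∀ k, F.sp k = G.sp k) : F = G := by
  ext1
  funext i
  rw [← sp_val, ← sp_val, h]

theorem mem_springerFiber_iff (u : Module.End ℂ (Fin n → ℂ)) (F : CompleteFlag n) :
    F ∈ springerFiber u ↔ ∀ k, ∀ v ∈ F.sp k, u v ∈ F.sp k := by
  constructor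
  · exact fun h k => h _
  · intro h i
    rw [← sp_val]
    exact h i

theorem sp_flagOfBasis (b : Module.Basis (Fin n) ℂ (Fin n → ℂ)) (k : ℕ) :
    (flagOfBasis b).sp k = Submodule.span ℂ (b '' {l | (l : ℕ) < k}) := by
  change Submodule.span ℂ _ = _
  congr 2
  ext l
  have := l.2
  simp [Fin.lt_def]

/-- Closedness is tested on bases, so every flag has to come from one. -/
theorem exists_basis (F : CompleteFlag n) :
    ∃ b : Module.Basis (Fin n) ℂ (Fin n → ℂ), flagOfBasis b = F := by
  classical
  have hex : ∀ k : Fin n, ∃ v ∈ F.space k.succ, v ∉ F.space k.castSucc := by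
    intro k
    by_contra! h
    have := Submodule.finrank_mono h
    rw [F.finrank_eq, F.finrank_eq] at this
    simp at this
  choose v hv1 hv2 using hex
  have hspan : ∀ i : Fin (n + 1), Submodule.span ℂ (v '' {k | k.castSucc < i}) = F.space i := by
    intro i
    induction i using Fin.induction with
    | zero =>
      have h1 : F.space 0 = ⊥ := Submodule.finrank_eq_zero.1 (F.finrank_eq 0)
      simp [h1]
    | succ k ih =>
      have h1 : {l : Fin n | l.castSucc < k.succ} = insert k {l | l.castSucc < k.castSucc} := by
        ext l
        rw [Set.mem_insert_iff, Set.mem_ofPred_eq, Set.mem_ofPred_eq, Fin.castSucc_lt_succ_iff,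
          Fin.castSucc_lt_castSucc_iff, le_iff_eq_or_lt]
      rw [h1, Set.image_insert_eq, Submodule.span_insert, ih, sup_comm]
      refine Submodule.eq_of_le_of_finrank_eq (sup_le (F.mono (Fin.castSucc_lt_succ).le)
        ((Submodule.span_singleton_le_iff_mem _ _).2 (hv1 k))) ?_
      rw [finrank_sup_span_singleton, if_neg (hv2 k), F.finrank_eq, F.finrank_eq]
      simp
  have htop : ⊤ ≤ Submodule.span ℂ (Set.range v) := by
    have h1 : F.space (Fin.last n) = ⊤ := by
      apply Submodule.eq_top_of_finrank_eq
      rw [F.finrank_eq]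
      simp
    rw [← h1, ← hspan]
    exact Submodule.span_mono (Set.image_subset_range _ _)
  refine ⟨basisOfTopLeSpanOfCardEqFinrank v htop (by simp), ?_⟩
  ext1
  funext i
  rw [← hspan]
  change Submodule.span ℂ _ = _
  rw [coe_basisOfTopLeSpanOfCardEqFinrank]

/-- The image of a flag under an automorphism of `ℂⁿ`. -/
def map (F : CompleteFlag n) (g : (Fin n → ℂ) ≃ₗ[ℂ] (Fin n → ℂ)) : CompleteFlag n where
  space i := (F.space i).map (g : (Fin n → ℂ) →ₗ[ℂ] (Fin n → ℂ))
  mono _ _ h := Submodule.map_mono (F.mono h)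
  finrank_eq i := by rw [LinearEquiv.finrank_map_eq, F.finrank_eq]

theorem sp_map (F : CompleteFlag n) (g : (Fin n → ℂ) ≃ₗ[ℂ] (Fin n → ℂ)) (k : ℕ) :
    (F.map g).sp k = (F.sp k).map (g : (Fin n → ℂ) →ₗ[ℂ] (Fin n → ℂ)) := rfl

theorem flagOfBasis_map (b : Module.Basis (Fin n) ℂ (Fin n → ℂ))
    (g : (Fin n → ℂ) ≃ₗ[ℂ] (Fin n → ℂ)) : flagOfBasis (b.map g) = (flagOfBasis b).map g := by
  refine ext_sp fun k => ?_
  rw [sp_map, sp_flagOfBasis, sp_flagOfBasis, Submodule.map_span, Set.image_image]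
  rfl

end CompleteFlag

/-- A Zariski closed set that contains the flags `(1 + t h) F` for infinitely many `t`
contains `F`. -/
theorem IsZariskiClosed.mem_of_infinite {n : ℕ} {Z : Set (CompleteFlag n)}
    (hZ : IsZariskiClosed Z) (F : CompleteFlag n) (h : Module.End ℂ (Fin n → ℂ)) {I : Set ℂ}
    (hI : I.Infinite)
    (hF : ∀ t ∈ I, ∃ g : (Fin n → ℂ) ≃ₗ[ℂ] (Fin n → ℂ), (∀ v, g v = v + t • h v) ∧
      F.map g ∈ Z) : F ∈ Z := by
  obtain ⟨S, hS⟩ := hZ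
  obtain ⟨b, rfl⟩ := F.exists_basis
  rw [hS]
  intro p hp
  -- The equation `p` along the curve of bases (1 + t h) b, a polynomial in t; infinitely many roots
  -- force it to vanish at t = 0 too.
  let q : Polynomial ℂ := MvPolynomial.aeval (fun k : Fin n × Fin n =>
    Polynomial.C (b k.1 k.2) + Polynomial.X * Polynomial.C (h (b k.1) k.2)) p
  have hq : ∀ t, q.eval t =
      MvPolynomial.eval (fun k : Fin n × Fin n => b k.1 k.2 + t * h (b k.1) k.2) p := by
    intro t
    have h1 : (Polynomial.aeval t : Polynomial ℂ →ₐ[ℂ] ℂ) q = MvPolynomial.aeval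
        (fun k : Fin n × Fin n => b k.1 k.2 + t * h (b k.1) k.2) p := by
      rw [← AlgHom.comp_apply, MvPolynomial.comp_aeval]
      congr 2
      funext k
      simp [mul_comm t]
    rw [Polynomial.coe_aeval_eq_eval, MvPolynomial.aeval_eq_eval] at h1
    exact h1
  have hq0 : q = 0 := by
    refine Polynomial.eq_zero_of_infinite_isRoot q (hI.mono fun t ht => ?_)
    obtain ⟨g, hg, hgZ⟩ := hF t ht
    rw [← CompleteFlag.flagOfBasis_map, hS] at hgZ
    have := hgZ p hp
    rw [Set.mem_ofPred_eq, Polynomial.IsRoot.def, hq, ← this]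
    congr 2
    funext k
    simp [hg]
  have := hq 0
  rw [hq0] at this
  simpa using this.symm

/-- The rank of `f` on a subquotient of a flag is lower semicontinuous. -/
theorem isZariskiClosed_finrank_le {n : ℕ} (f : Module.End ℂ (Fin n → ℂ)) (i j d : ℕ) :
    IsZariskiClosed {F : CompleteFlag n |
      Module.finrank ℂ ↥((F.sp j).map f ⊔ F.sp i) ≤ d} := by
  classical
  -- All polynomials vanishing on the set serve as equations; it remains to find one that does not
  -- vanish at a given basis outside it.
  refine ⟨{p | ∀ b : Module.Basis (Fin n) ℂ (Fin n → ℂ), Module.finrank ℂ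
    ↥(((flagOfBasis b).sp j).map f ⊔ (flagOfBasis b).sp i) ≤ d →
      MvPolynomial.eval (fun k => b k.1 k.2) p = 0}, fun b => ⟨fun h p hp => hp b h, fun h => ?_⟩⟩
  -- the generators of `f V_j + V_i`
  let ι := {k : Fin n // (k : ℕ) < j} ⊕ {k : Fin n // (k : ℕ) < i}
  let idx : ι → Fin n := Sum.elim Subtype.val Subtype.val
  let L : ι → Module.End ℂ (Fin n → ℂ) := Sum.elim (fun _ => f) (fun _ => 1)
  have hspan : ∀ b : Module.Basis (Fin n) ℂ (Fin n → ℂ),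
      Submodule.span ℂ (Set.range fun x => L x (b (idx x))) =
        ((flagOfBasis b).sp j).map f ⊔ (flagOfBasis b).sp i := by
    intro b
    rw [CompleteFlag.sp_flagOfBasis, CompleteFlag.sp_flagOfBasis, Submodule.map_span,
      ← Submodule.span_union]
    congr 1
    ext w
    simp [ι, L, idx]
  by_contra hd
  rw [Set.mem_ofPred_eq, not_le] at hd
  obtain ⟨κ, a, ha, hκ, hli⟩ := exists_linearIndependent' ℂ fun x => L x (b (idx x))
  have : Finite κ := Finite.of_injective a ha
  have := Fintype.ofFinite κ
  rw [hspan] at hκ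
  have hcard : d < Fintype.card κ := by
    rw [← finrank_span_eq_card hli, hκ]
    exact hd
  obtain ⟨g, hg⟩ := (Fintype.linearCombination ℂ
    ((fun x => L x (b (idx x))) ∘ a)).exists_leftInverse_of_injective
      (LinearMap.ker_eq_bot.2 (hli.fintypeLinearCombination_injective))
  -- As `g` is a left inverse for the independent generators chosen at `b`, the determinant is 1 at
  -- `b`. It vanishes wherever these more than `d` generators become dependent, hence wherever the
  -- rank is at most `d`.
  let P : Matrix κ κ (MvPolynomial (Fin n × Fin n) ℂ) := Matrix.of fun s t => ∑ l : Fin n,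
    MvPolynomial.X (idx (a t), l) * MvPolynomial.C (g (L (a t) (Pi.single l 1)) s)
  have hP : ∀ (b' : Module.Basis (Fin n) ℂ (Fin n → ℂ)),
      MvPolynomial.eval (fun k => b' k.1 k.2) P.det =
        (Matrix.of fun s t => g (L (a t) (b' (idx (a t)))) s).det := by
    intro b'
    rw [RingHom.map_det]
    congr 1
    ext s t
    have h1 : b' (idx (a t)) = ∑ l, b' (idx (a t)) l • (Pi.single l 1 : Fin n → ℂ) := by
      exact pi_eq_sum_univ' _
    rw [Matrix.of_apply]
    conv_rhs => rw [h1]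
    simp [P]
  have h1 := h P.det (by
    intro b' hb'
    rw [hP]
    have hnli : ¬ LinearIndependent ℂ ((fun x => L x (b' (idx x))) ∘ a) := by
      intro hli'
      have h2 := finrank_span_eq_card hli'
      have h3 := Submodule.finrank_mono (Submodule.span_mono (R := ℂ)
        (Set.range_comp_subset_range a (fun x => L x (b' (idx x)))))
      rw [hspan] at h3
      omega
    obtain ⟨c, hc, t, hct⟩ := Fintype.not_linearIndependent_iff.1 hnli
    refine Matrix.exists_mulVec_eq_zero_iff.1 ⟨c, fun h => hct (congrFun h t), ?_⟩
    have h4 := congrArg g hc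
    rw [map_sum, map_zero] at h4
    funext s
    have h5 := congrFun h4 s
    simp only [Finset.sum_apply, map_smul, Pi.smul_apply, smul_eq_mul, Function.comp_apply] at h5
    simp only [Matrix.mulVec, dotProduct, Matrix.of_apply]
    rw [← h5]
    exact Finset.sum_congr rfl fun t _ => mul_comm _ _)
  rw [hP] at h1
  have h6 : (Matrix.of fun s t => g (L (a t) (b (idx (a t)))) s) = (1 : Matrix κ κ ℂ) := by
    ext s t
    have h7 := LinearMap.congr_fun hg (Pi.single t 1)
    have h8 := congrFun h7 s
    simp at h8
    rw [Matrix.of_apply, Matrix.one_apply, h8, Pi.single_apply]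
  rw [h6, Matrix.det_one] at h1
  exact one_ne_zero h1

/-! ### The closure of the Spaltenstein sets -/

theorem CompleteFlag.exists_sp_succ_eq {n : ℕ} (F : CompleteFlag n) {i : ℕ} (hi : i < n) :
    ∃ v ∉ F.sp i, F.sp (i + 1) = F.sp i ⊔ Submodule.span ℂ {v} := by
  classical
  have hex : ∃ v ∈ F.sp (i + 1), v ∉ F.sp i := by
    by_contra! h
    have := Submodule.finrank_mono h
    rw [F.finrank_sp hi, F.finrank_sp hi.le] at this
    omega
  obtain ⟨v, hv1, hv2⟩ := hex
  refine ⟨v, hv2, (Submodule.eq_of_le_of_finrank_eq (sup_le (F.sp_mono (Nat.le_succ i))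
    ((Submodule.span_singleton_le_iff_mem _ _).2 hv1)) ?_).symm⟩
  rw [finrank_sup_span_singleton, if_neg hv2, F.finrank_sp hi, F.finrank_sp hi.le]

/-- Modulo `A`, `v` is an eigenvector of the nilpotent `u`, so its eigenvalue is 0. -/
theorem map_mem_of_isNilpotent {V : Type*} [AddCommGroup V] [Module ℂ V] {u : Module.End ℂ V}
    (hu : IsNilpotent u) {A : Submodule ℂ V} (hA : ∀ v ∈ A, u v ∈ A) {v : V} (hv : v ∉ A)
    (huv : u v ∈ A ⊔ Submodule.span ℂ {v}) : u v ∈ A := by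
  obtain ⟨a, ha, w, hw, haw⟩ := Submodule.mem_sup.1 huv
  obtain ⟨α, rfl⟩ := Submodule.mem_span_singleton.1 hw
  have hpow : ∀ k, (u ^ k) v - α ^ k • v ∈ A := by
    intro k
    induction k with
    | zero => simp
    | succ k ih =>
      have h1 := A.add_mem (hA _ ih) (A.smul_mem (α ^ k) ha)
      rw [map_sub, map_smul, ← haw] at h1
      rw [pow_succ', Module.End.mul_apply, pow_succ, mul_smul]
      convert h1 using 1
      rw [smul_add]
      abel
  obtain ⟨N, hN⟩ := hu
  have h1 := hpow N
  rw [hN, LinearMap.zero_apply, zero_sub, Submodule.neg_mem_iff] at h1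
  have hα : α = 0 := by
    by_contra hne
    exact hv ((Submodule.smul_mem_iff _ (pow_ne_zero N hne)).1 h1)
  rw [← haw, hα, zero_smul, add_zero]
  exact ha

/-- The flags in the Springer fiber such that `u` on `V_k / V_i` has the Jordan type `Y_{k/i}^T`
for `i ≤ k ≤ j`. -/
def subquotientSet {Y : YoungDiagram} (u : Module.End ℂ (Fin Y.card → ℂ))
    (T : StandardTableau Y) (i j : ℕ) : Set (CompleteFlag Y.card) :=
  {F | F ∈ springerFiber u ∧ ∀ k, i ≤ k → k ≤ j →
    HasSubquotientType u (F.sp i) (F.sp k) (T.subquotientShape i k)}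

/-- The elementary deformation, correcting the type of V_{j+1} / V_{i+1}. The automorphisms fix V_i
pointwise, preserve V_k for k ≥ j and commute with u on V_j modulo V_i, so no type already correct
is lost. -/
theorem subquotientSet_inter_subset {Y : YoungDiagram} {u : Module.End ℂ (Fin Y.card → ℂ)}
    (hu : IsNilpotent u) (T : StandardTableau Y) {i j : ℕ} (hij : i < j) (hj : j < Y.card)
    {Z : Set (CompleteFlag Y.card)} (hZ : IsZariskiClosed Z)
    (h : subquotientSet u T i Y.card ∩ subquotientSet u T (i + 1) (j + 1) ⊆ Z) :
    subquotientSet u T i Y.card ∩ subquotientSet u T (i + 1) j ⊆ Z := by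
  rintro F ⟨⟨hF, hF1⟩, -, hF2⟩
  rw [CompleteFlag.mem_springerFiber_iff] at hF
  obtain ⟨x, e, hx, hl, he, hν, hl'⟩ := T.subquotientShape_local_rule hij hj
  obtain ⟨v, hv, hvi⟩ := F.exists_sp_succ_eq (hij.trans hj)
  have huv : u v ∈ F.sp i := by
    refine map_mem_of_isNilpotent hu (hF i) hv ?_
    rw [← hvi]
    refine hF _ v ?_
    rw [hvi]
    exact Submodule.mem_sup_right (Submodule.mem_span_singleton_self v)
  have h3 := hF2 j hij le_rfl
  rw [hvi] at h3
  rcases HasSubquotientType.step (hF i) (hF j) (hF (j + 1)) (F.sp_mono (Nat.le_succ j)) hv huv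
    (hF1 j hij.le hj.le) (hF1 (j + 1) (by omega) hj) h3 hx hl he hν hl' with
    hgood | ⟨c, m, hm, hcm, hmW, hvc, hvH, hvW, hgood⟩
  · refine h ⟨⟨(CompleteFlag.mem_springerFiber_iff u F).2 hF, hF1⟩,
      (CompleteFlag.mem_springerFiber_iff u F).2 hF, fun k hk1 hk2 => ?_⟩
    rcases Nat.le_succ_iff.1 hk2 with hk | rfl
    · exact hF2 k hk1 hk
    · rw [hvi]
      exact hgood
  obtain ⟨f, hfA, hfH, hfu, hfv⟩ := exists_commuting_endomorphism u (hF i) (hF j) hm hcm hvH huv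
  refine hZ.mem_of_infinite F f (exists_linearEquiv_add_smul f) ?_
  rintro t ⟨ht, g, hg⟩
  refine ⟨g, hg, ?_⟩
  have hgA : ∀ a ∈ F.sp i, g a = a := fun a ha => by rw [hg, hfA a ha, smul_zero, add_zero]
  have hgu : ∀ w ∈ F.sp j, u (g w) - g (u w) ∈ F.sp i := by
    intro w hw
    have : u (g w) - g (u w) = t • (u (f w) - f (u w)) := by
      rw [hg, hg, map_add, map_smul, smul_sub]
      abel
    rw [this]
    exact Submodule.smul_mem _ _ (hfu w hw)
  have hlow : ∀ k ≤ i, (F.map g).sp k = F.sp k := by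
    intro k hk
    rw [CompleteFlag.sp_map]
    refine Submodule.eq_of_le_of_finrank_eq ?_ (LinearEquiv.finrank_map_eq _ _)
    rintro _ ⟨w, hw, rfl⟩
    change g w ∈ _
    rw [hgA w (F.sp_mono hk hw)]
    exact hw
  have hhigh : ∀ k, j ≤ k → (F.map g).sp k = F.sp k := by
    intro k hk
    rw [CompleteFlag.sp_map]
    refine Submodule.eq_of_le_of_finrank_eq ?_ (LinearEquiv.finrank_map_eq _ _)
    rintro _ ⟨w, hw, rfl⟩
    change g w ∈ _
    rw [hg]
    exact Submodule.add_mem _ hw (Submodule.smul_mem _ _ (F.sp_mono hk (hfH w)))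
  have hstab : F.map g ∈ springerFiber u := by
    rw [CompleteFlag.mem_springerFiber_iff]
    intro k
    rcases le_or_gt k i with hk | hk
    · rw [hlow k hk]
      exact hF k
    rcases le_or_gt j k with hk' | hk'
    · rw [hhigh k hk']
      exact hF k
    rintro _ ⟨w, hw, rfl⟩
    have h1 := hgu w (F.sp_mono hk'.le hw)
    have h2 : u (g w) = g (u w) + (u (g w) - g (u w)) := by abel
    change u (g w) ∈ _
    rw [h2]
    exact Submodule.add_mem _ ⟨_, hF k w hw, rfl⟩ ⟨_, F.sp_mono hk.le h1, hgA _ h1⟩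
  have hmap : ∀ k k' l, i ≤ k → k' ≤ j → HasSubquotientType u (F.sp k) (F.sp k') l →
      HasSubquotientType u ((F.map g).sp k) ((F.map g).sp k') l := fun k k' l hk hk' hkk =>
    hkk.map g (hF i) (hF j) hgA hgu (F.sp_mono hk) (F.sp_mono hk')
  refine h ⟨⟨hstab, fun k hk1 hk2 => ?_⟩, hstab, fun k hk1 hk2 => ?_⟩
  · rcases le_or_gt k j with hk | hk
    · exact hmap _ _ _ le_rfl hk (hF1 k hk1 hk2)
    · rw [hlow i le_rfl, hhigh k hk.le]
      exact hF1 k hk1 hk2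
  · rcases Nat.le_succ_iff.1 hk2 with hk | rfl
    · exact hmap _ _ _ (Nat.le_succ i) hk (hF2 k hk1 hk)
    · have hgv : g v = v + t • (u ^ c) m := by rw [hg, hfv]
      have h1 : (F.map g).sp (i + 1) = F.sp i ⊔ Submodule.span ℂ {g v} := by
        rw [CompleteFlag.sp_map, hvi, Submodule.map_sup, Submodule.map_span,
          Set.image_singleton]
        congr 1
        exact hlow i le_rfl
      rw [h1, hhigh _ (Nat.le_succ j)]
      -- `v` lies in this space and u^c m does not, so every t ≠ 0 moves the line out of it.
      have h2 : g v ∉ (F.sp (j + 1)).map (u ^ (c + 1)) ⊔ F.sp i := by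
        intro h2
        rw [hgv] at h2
        have h4 := Submodule.sub_mem _ h2 hvW
        rw [add_sub_cancel_left, Submodule.smul_mem_iff _ ht] at h4
        exact hmW h4
      refine hgood (g v) (fun h4 => h2 (Submodule.mem_sup_right h4)) ?_ h2
      rw [hgv]
      exact Submodule.add_mem _ hvc
        (Submodule.smul_mem _ t (Submodule.mem_sup_left ⟨m, hm, rfl⟩))

/-- Descending induction on j, from j = n, where the hypothesis applies, to j = i + 1, where the
only condition concerns V_{i+1} / V_{i+1} = 0. -/
theorem subquotientSet_subset {Y : YoungDiagram} {u : Module.End ℂ (Fin Y.card → ℂ)}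
    (hu : IsNilpotent u) (T : StandardTableau Y) {i : ℕ} (hi : i + 1 < Y.card)
    {Z : Set (CompleteFlag Y.card)} (hZ : IsZariskiClosed Z)
    (h : subquotientSet u T (i + 1) Y.card ⊆ Z) : subquotientSet u T i Y.card ⊆ Z := by
  have key : ∀ d j, j + d = Y.card → i < j →
      subquotientSet u T i Y.card ∩ subquotientSet u T (i + 1) j ⊆ Z := by
    intro d
    induction d with
    | zero =>
      rintro j rfl -
      exact Set.inter_subset_right.trans h
    | succ d ih =>
      intro j hj hij
      exact subquotientSet_inter_subset hu T hij (by omega) hZ (ih (j + 1) (by omega) (by omega))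
  intro F hF
  refine key (Y.card - (i + 1)) (i + 1) (by omega) (Nat.lt_succ_self i) ⟨hF, hF.1, ?_⟩
  intro k hk1 hk2 m
  obtain rfl : k = i + 1 := le_antisymm hk2 hk1
  have h1 : (F.sp (i + 1)).map (u ^ m) ⊔ F.sp (i + 1) = F.sp (i + 1) := by
    rw [sup_eq_right]
    have h2 := (CompleteFlag.mem_springerFiber_iff u F).1 hF.1 (i + 1)
    have h3 := map_pow_antitone u h2 (Nat.zero_le m)
    simpa [Module.End.one_eq_id] using h3
  rw [h1, YoungDiagram.cardFromCol, T.subquotientShape_self hi]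
  simp

theorem subquotientSet_zero_subset {Y : YoungDiagram} {u : Module.End ℂ (Fin Y.card → ℂ)}
    (hu : IsNilpotent u) (T : StandardTableau Y) {Z : Set (CompleteFlag Y.card)}
    (hZ : IsZariskiClosed Z) : ∀ i < Y.card, subquotientSet u T i Y.card ⊆ Z →
      subquotientSet u T 0 Y.card ⊆ Z := by
  intro i
  induction i with
  | zero => exact fun _ h => h
  | succ i ih => exact fun hi h => ih (by omega) (subquotientSet_subset hu T hi hZ h)

/-! ### Jordan bases -/

section JordanBasis

variable {W : Type*} [AddCommGroup W] [Module ℂ W] {Y : YoungDiagram} {f : Module.End ℂ W}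
  {e : Module.Basis Y.cells ℂ W}

theorem IsJordanBasis.pow_apply_of_lt (h : IsJordanBasis f e) (k : ℕ) (x : Y.cells)
    (hx : x.1.2 < k) : (f ^ k) (e x) = 0 := by
  induction k generalizing x with
  | zero => omega
  | succ k ih =>
    rw [pow_succ, Module.End.mul_apply]
    by_cases hx0 : x.1.2 = 0
    · rw [h.1 x hx0, map_zero]
    · have hm : (x.1.1, x.1.2 - 1) ∈ Y.cells :=
        Y.up_left_mem le_rfl (Nat.sub_le _ _) (show (x.1.1, x.1.2) ∈ Y from x.2)
      rw [h.2 x ⟨_, hm⟩ rfl (by dsimp only; omega)]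
      exact ih ⟨_, hm⟩ (by dsimp only; omega)

theorem IsJordanBasis.pow_apply (h : IsJordanBasis f e) (k : ℕ) (x x' : Y.cells)
    (h1 : x.1.1 = x'.1.1) (h2 : x.1.2 = x'.1.2 + k) : (f ^ k) (e x) = e x' := by
  induction k generalizing x with
  | zero =>
    obtain rfl : x = x' := Subtype.ext (Prod.ext h1 h2)
    simp
  | succ k ih =>
    have hm : (x.1.1, x.1.2 - 1) ∈ Y.cells :=
      Y.up_left_mem le_rfl (Nat.sub_le _ _) (show (x.1.1, x.1.2) ∈ Y from x.2)
    rw [pow_succ, Module.End.mul_apply, h.2 x ⟨_, hm⟩ rfl (by dsimp only; omega)]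
    exact ih ⟨_, hm⟩ h1 (by dsimp only; omega)

theorem IsJordanBasis.isNilpotent (h : IsJordanBasis f e) : IsNilpotent f := by
  refine ⟨Y.rowLen 0, e.ext fun x => ?_⟩
  rw [LinearMap.zero_apply]
  refine h.pow_apply_of_lt _ x ?_
  exact YoungDiagram.mem_iff_lt_rowLen.1
    (Y.up_left_mem (Nat.zero_le _) le_rfl (show (x.1.1, x.1.2) ∈ Y from x.2))

/-- The image of f^k is spanned by the e_x for which the box k steps to the right of x is in `Y`;
these boxes are those in the columns ≥ k. -/
theorem IsJordanBasis.finrank_range_pow (h : IsJordanBasis f e) (k : ℕ) :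
    Module.finrank ℂ (f ^ k).range = Y.cardFromCol k := by
  have h1 : (f ^ k).range =
      Submodule.span ℂ (e '' {x | (x.1.1, x.1.2 + k) ∈ Y.cells}) := by
    rw [LinearMap.range_eq_map, ← e.span_eq, Submodule.map_span, ← Set.range_comp]
    apply le_antisymm
    · refine Submodule.span_le.2 ?_
      rintro _ ⟨x, rfl⟩
      rcases lt_or_ge x.1.2 k with hx | hx
      · rw [Function.comp_apply, h.pow_apply_of_lt k x hx]
        exact Submodule.zero_mem _
      · have hm : (x.1.1, x.1.2 - k) ∈ Y.cells :=
          Y.up_left_mem le_rfl (Nat.sub_le _ _) (show (x.1.1, x.1.2) ∈ Y from x.2)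
        rw [Function.comp_apply, h.pow_apply k x ⟨_, hm⟩ rfl (by dsimp only; omega)]
        refine Submodule.subset_span ⟨⟨_, hm⟩, ?_, rfl⟩
        change (x.1.1, x.1.2 - k + k) ∈ Y.cells
        rw [Nat.sub_add_cancel hx]
        exact x.2
    · refine Submodule.span_mono ?_
      rintro _ ⟨x, hx, rfl⟩
      exact ⟨⟨_, hx⟩, h.pow_apply k _ x rfl rfl⟩
  have hinj : Function.Injective fun x : Y.cells => ((x.1.1, x.1.2 + k) : ℕ × ℕ) := by
    intro x y hxy
    simp only [Prod.mk.injEq] at hxy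
    exact Subtype.ext (Prod.ext hxy.1 (by omega))
  rw [h1, finrank_span_basis_image, YoungDiagram.cardFromCol, ← Set.ncard_coe_finset,
    ← Set.ncard_image_of_injective _ hinj]
  congr 1
  ext y
  simp only [Set.mem_image, Set.mem_ofPred_eq, Finset.coe_filter]
  constructor
  · rintro ⟨x, hx, rfl⟩
    exact ⟨hx, by simp⟩
  · rintro ⟨hy, hk⟩
    have hm : (y.1, y.2 - k) ∈ Y.cells :=
      Y.up_left_mem le_rfl (Nat.sub_le _ _) (show (y.1, y.2) ∈ Y from hy)
    have h2 : ((y.1, y.2 - k + k) : ℕ × ℕ) = y := by rw [Nat.sub_add_cancel hk]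
    exact ⟨⟨_, hm⟩, by simpa only [h2] using hy, h2⟩

end JordanBasis

/-- Needed for `setK Y ⊆ setR Y`: the condition defining `setK` would be vacuous without such a `u`.
-/
theorem exists_isJordanBasis (Y : YoungDiagram) :
    ∃ (u : Module.End ℂ (Fin Y.card → ℂ)) (e : Module.Basis Y.cells ℂ (Fin Y.card → ℂ)),
      IsJordanBasis u e := by
  let e : Module.Basis Y.cells ℂ (Fin Y.card → ℂ) :=
    (Pi.basisFun ℂ (Fin Y.card)).reindex (Finset.equivFinOfCardEq rfl).symm
  refine ⟨e.constr ℂ fun x => if x.1.2 = 0 then 0 else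
    e ⟨(x.1.1, x.1.2 - 1),
      Y.up_left_mem le_rfl (Nat.sub_le _ _) (show (x.1.1, x.1.2) ∈ Y from x.2)⟩, e, ?_, ?_⟩
  · intro x hx
    rw [Module.Basis.constr_basis, if_pos hx]
  · intro x x' h1 h2
    rw [Module.Basis.constr_basis, if_neg (by omega)]
    congr 1
    exact Subtype.ext (Prod.ext h1 (by dsimp only; omega))

theorem finrank_map_pow_of_hasJordanType {V : Type*} [AddCommGroup V] [Module ℂ V]
    {u : Module.End ℂ V} {S : Submodule ℂ V} (hS : ∀ v ∈ S, u v ∈ S) {l : YoungDiagram}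
    (h : HasJordanType (u.restrict hS) l) (k : ℕ) :
    Module.finrank ℂ (S.map (u ^ k)) = l.cardFromCol k := by
  obtain ⟨e, he⟩ := h
  have hpow : ∀ k, ∀ w : S, (((u.restrict hS) ^ k) w : V) = (u ^ k) w := by
    intro k
    induction k with
    | zero => intro w; simp
    | succ k ih =>
      intro w
      rw [pow_succ', pow_succ', Module.End.mul_apply, Module.End.mul_apply, ← ih]
      rfl
  have hmap : S.map (u ^ k) = ((u.restrict hS) ^ k).range.map S.subtype := by
    ext w
    constructor
    · rintro ⟨v, hv, rfl⟩
      exact ⟨_, ⟨⟨v, hv⟩, rfl⟩, hpow k ⟨v, hv⟩⟩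
    · rintro ⟨_, ⟨v, rfl⟩, rfl⟩
      exact ⟨v, v.2, (hpow k v).symm⟩
  rw [hmap, Submodule.finrank_map_subtype_eq, he.finrank_range_pow k]

theorem spaltensteinSet_subset {Y : YoungDiagram} (u : Module.End ℂ (Fin Y.card → ℂ))
    (T : StandardTableau Y) : spaltensteinSet u T ⊆ subquotientSet u T 0 Y.card := by
  rintro F ⟨hF, hT⟩
  refine ⟨hF, fun j _ hj k => ?_⟩
  have h0 : F.sp 0 = ⊥ := Submodule.finrank_eq_zero.1 (F.finrank_sp (Nat.zero_le _))
  rw [h0, sup_bot_eq, finrank_bot, zero_add, T.subquotientShape_zero]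
  -- ℬ_u^T imposes no condition at j = 0, where both sides are 0.
  rcases Nat.eq_zero_or_pos j with rfl | hj0
  · have h1 : (T.subShape 0).cells = ∅ := Finset.card_eq_zero.1 (T.card_subShape hj)
    rw [h0, YoungDiagram.cardFromCol, h1]
    simp
  · have h1 := hT ⟨j, Nat.lt_succ_of_le hj⟩ hj0
    have h2 := finrank_map_pow_of_hasJordanType _ h1 k
    rw [← h2, ← F.sp_val]

/-- On the component `𝒦^T` the ranks on the subquotients are at most those of `Y_{j/i}^T`. -/
theorem finrank_le_of_mem_springerComponent {Y : YoungDiagram}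
    {u : Module.End ℂ (Fin Y.card → ℂ)} (hu : IsNilpotent u) {T : StandardTableau Y}
    {F : CompleteFlag Y.card} (hF : F ∈ springerComponent u T) {i j : ℕ} (hij : i < j)
    (hj : j ≤ Y.card) (k : ℕ) :
    Module.finrank ℂ ↥((F.sp j).map (u ^ k) ⊔ F.sp i) ≤
      i + (T.subquotientShape i j).cardFromCol k := by
  refine Set.mem_sInter.1 hF.2 {F : CompleteFlag Y.card |
    Module.finrank ℂ ↥((F.sp j).map (u ^ k) ⊔ F.sp i) ≤
      i + (T.subquotientShape i j).cardFromCol k} ⟨isZariskiClosed_finrank_le _ _ _ _, ?_⟩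
  refine (spaltensteinSet_subset u T).trans (subquotientSet_zero_subset hu T
    (isZariskiClosed_finrank_le _ _ _ _) i (by omega) ?_)
  rintro G ⟨-, hG⟩
  have h1 := hG j hij.le hj k
  rw [G.finrank_sp (by omega)] at h1
  exact h1.le

/-! ### The flags `F_τ` -/

/-- At most k of the counted boxes are within the last k columns up to the rightmost one. From any
other, the box k steps to the right is not beyond the rightmost one, so its entry is still at most
j. -/
theorem RowStandardTableau.rowSize_le {Y : YoungDiagram} (τ : RowStandardTableau Y)
    (i j r k : ℕ) : τ.rowSize i j r ≤ ((Finset.univ : Finset Y.cells).filter fun x =>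
      (i < τ.entry x ∧ ∃ x' : Y.cells, x'.1.1 = x.1.1 ∧ x'.1.2 = x.1.2 + k ∧ τ.entry x' ≤ j) ∧
        x.1.1 = r).card + k := by
  classical
  unfold RowStandardTableau.rowSize
  set B := (Finset.univ : Finset Y.cells).filter fun x =>
    x.1.1 = r ∧ i < τ.entry x ∧ τ.entry x ≤ j with hB
  rcases B.eq_empty_or_nonempty with h | h
  · rw [h]
    simp
  obtain ⟨m, hm, hmax⟩ := B.exists_max_image (fun x => x.1.2) h
  have hmB := (Finset.mem_filter.1 hm).2
  have h1 : (B.filter fun x => m.1.2 < x.1.2 + k).card ≤ k := by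
    have h2 : ((B.filter fun x => m.1.2 < x.1.2 + k).image fun x => x.1.2) ⊆
        Finset.Ico (m.1.2 + 1 - k) (m.1.2 + 1) := by
      intro c hc
      obtain ⟨x, hx, rfl⟩ := Finset.mem_image.1 hc
      obtain ⟨hx1, hx2⟩ := Finset.mem_filter.1 hx
      have := hmax x hx1
      rw [Finset.mem_Ico]
      omega
    have h3 := Finset.card_le_card h2
    rw [Finset.card_image_of_injOn, Nat.card_Ico] at h3
    · omega
    · intro x hx y hy hxy
      have hx1 := (Finset.mem_filter.1 (Finset.mem_filter.1 hx).1).2.1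
      have hy1 := (Finset.mem_filter.1 (Finset.mem_filter.1 hy).1).2.1
      exact Subtype.ext (Prod.ext (hx1.trans hy1.symm) hxy)
  refine le_trans ?_ (Nat.add_le_add_left h1 _)
  refine (Finset.card_le_card ?_).trans (Finset.card_union_le _ _)
  intro x hx
  have hxB := (Finset.mem_filter.1 hx).2
  rw [Finset.mem_union, Finset.mem_filter, Finset.mem_filter]
  rcases lt_or_ge m.1.2 (x.1.2 + k) with hk | hk
  · exact Or.inr ⟨hx, hk⟩
  · have hY : (x.1.1, x.1.2 + k) ∈ Y.cells := by
      rw [hxB.1, ← hmB.1]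
      exact Y.up_left_mem le_rfl hk (show (m.1.1, m.1.2) ∈ Y from m.2)
    refine Or.inl ⟨Finset.mem_univ _, ⟨hxB.2.1, ⟨_, hY⟩, rfl, rfl, ?_⟩, hxB.1⟩
    refine le_trans ?_ hmB.2.2
    rcases hk.lt_or_eq with hlt | heq
    · exact (τ.row_lt ⟨_, hY⟩ m (hxB.1.trans hmB.1.symm) hlt).le
    · have : (⟨_, hY⟩ : Y.cells) = m := Subtype.ext (Prod.ext (hxB.1.trans hmB.1.symm) heq)
      exact (congrArg τ.entry this).le

/-- The space contains the e_x with entry at most i, and every e_x = u^k e_{x'} where x' is k steps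
to the right of x with entry at most j. Those of the second kind with entry above i are counted by
rows. -/
theorem sum_rowSize_le_finrank {Y : YoungDiagram} {u : Module.End ℂ (Fin Y.card → ℂ)}
    {e : Module.Basis Y.cells ℂ (Fin Y.card → ℂ)} (he : IsJordanBasis u e)
    (τ : RowStandardTableau Y) {i j : ℕ} (hij : i < j) (hj : j ≤ Y.card) (k : ℕ) :
    i + ∑ r ∈ Finset.range (Y.colLen 0), (τ.rowSize i j r - k) ≤
      Module.finrank ℂ
        ↥(((tableauFlag e τ).sp j).map (u ^ k) ⊔ (tableauFlag e τ).sp i) := by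
  classical
  have hsp : ∀ m ≤ Y.card, (tableauFlag e τ).sp m =
      Submodule.span ℂ (e '' {x | τ.entry x ≤ m}) := by
    intro m hm
    change Submodule.span ℂ (e '' {x | τ.entry x ≤ min m Y.card}) = _
    rw [min_eq_left hm]
  let A := (Finset.univ : Finset Y.cells).filter fun x => τ.entry x ≤ i
  let B := (Finset.univ : Finset Y.cells).filter fun x =>
    i < τ.entry x ∧ ∃ x' : Y.cells, x'.1.1 = x.1.1 ∧ x'.1.2 = x.1.2 + k ∧ τ.entry x' ≤ j
  have hA : A.card = i := by
    have h1 := (tableauFlag e τ).finrank_sp (show i ≤ Y.card by omega)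
    rw [hsp i (by omega), finrank_span_basis_image] at h1
    rw [← Set.ncard_coe_finset, Finset.coe_filter]
    simpa using h1
  have hAB : Disjoint A B := by
    rw [Finset.disjoint_left]
    intro x hx hx'
    have h1 := (Finset.mem_filter.1 hx).2
    have h2 := (Finset.mem_filter.1 hx').2.1
    omega
  have hB : ∑ r ∈ Finset.range (Y.colLen 0), (τ.rowSize i j r - k) ≤ B.card := by
    rw [Finset.card_eq_sum_card_fiberwise (f := fun x : Y.cells => x.1.1)
      (t := Finset.range (Y.colLen 0))]
    · refine Finset.sum_le_sum fun r _ => ?_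
      have := τ.rowSize_le i j r k
      rw [Finset.filter_filter]
      omega
    · intro x _
      rw [Finset.mem_coe, Finset.mem_range]
      exact YoungDiagram.mem_iff_lt_colLen.1
        (Y.up_left_mem le_rfl (Nat.zero_le _) (show (x.1.1, x.1.2) ∈ Y from x.2))
  have hle : Submodule.span ℂ (e '' (A ∪ B : Finset Y.cells)) ≤
      ((tableauFlag e τ).sp j).map (u ^ k) ⊔ (tableauFlag e τ).sp i := by
    rw [hsp i (by omega), hsp j hj, Submodule.span_le]
    rintro _ ⟨x, hx, rfl⟩
    rcases Finset.mem_union.1 hx with hx | hx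
    · exact Submodule.mem_sup_right
        (Submodule.subset_span ⟨x, (Finset.mem_filter.1 hx).2, rfl⟩)
    · obtain ⟨-, x', h1, h2, h3⟩ := (Finset.mem_filter.1 hx).2
      exact Submodule.mem_sup_left
        ⟨e x', Submodule.subset_span ⟨x', h3, rfl⟩, he.pow_apply k x' x h1 h2⟩
  have h1 := Submodule.finrank_mono hle
  rw [finrank_span_basis_image, Set.ncard_coe_finset, Finset.card_union_of_disjoint hAB] at h1
  omega

/-! ### Dominance -/

theorem List.sum_range_getD_le_sum_map (f : ℕ → ℕ) (w : List ℕ) (hf : f 0 = 0) (p : ℕ) :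
    ∑ q ∈ Finset.range p, f (w.getD q 0) ≤ (w.map f).sum := by
  induction w generalizing p with
  | nil => simp [hf]
  | cons a w ih =>
    cases p with
    | zero => simp
    | succ p =>
      rw [Finset.sum_range_succ', List.map_cons, List.sum_cons, add_comm]
      simpa using ih p

theorem YoungDiagram.rowLen_ofRowLens_getD (w : List ℕ) (hw : w.SortedGE) (q : ℕ) :
    (YoungDiagram.ofRowLens w hw).rowLen q = w.getD q 0 := by
  rcases lt_or_ge q w.length with h | h
  · rw [List.getD_eq_getElem _ _ h]
    exact YoungDiagram.rowLen_ofRowLens (hw := hw) ⟨q, h⟩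
  · rw [List.getD_eq_default _ _ h]
    by_contra hne
    have h1 : (q, 0) ∈ YoungDiagram.ofRowLens w hw :=
      YoungDiagram.mem_iff_lt_rowLen.2 (Nat.pos_of_ne_zero hne)
    obtain ⟨h2, -⟩ := YoungDiagram.mem_ofRowLens.1 h1
    exact absurd h2 (not_lt.2 h)

/-- Boxes in the columns from `l.rowLen p` on lie in the first p rows, where row q has `l.rowLen q -
l.rowLen p` of them. -/
theorem YoungDiagram.mul_add_cardFromCol_le (l : YoungDiagram) (p : ℕ) :
    p * l.rowLen p + l.cardFromCol (l.rowLen p) ≤ ∑ q ∈ Finset.range p, l.rowLen q := by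
  have h1 : l.cardFromCol (l.rowLen p) ≤ ∑ q ∈ Finset.range p, (l.rowLen q - l.rowLen p) := by
    unfold YoungDiagram.cardFromCol
    rw [Finset.card_eq_sum_card_fiberwise (f := Prod.fst) (t := Finset.range p)]
    · refine Finset.sum_le_sum fun q _ => ?_
      rw [← Nat.card_Ico]
      refine Finset.card_le_card_of_injOn Prod.snd ?_ ?_
      · intro x hx
        simp only [Finset.coe_filter, Finset.mem_filter, Set.mem_ofPred_eq] at hx
        obtain ⟨⟨hx1, hx2⟩, rfl⟩ := hx
        rw [Finset.mem_coe, Finset.mem_Ico]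
        exact ⟨hx2, YoungDiagram.mem_iff_lt_rowLen.1 (show (x.1, x.2) ∈ l from hx1)⟩
      · intro x hx y hy hxy
        simp only [Finset.coe_filter, Set.mem_ofPred_eq] at hx hy
        exact Prod.ext (hx.2.trans hy.2.symm) hxy
    · intro x hx
      simp only [Finset.coe_filter, Set.mem_ofPred_eq] at hx
      rw [Finset.mem_coe, Finset.mem_range]
      by_contra hp
      have h2 := YoungDiagram.mem_iff_lt_rowLen.1 (show (x.1, x.2) ∈ l from hx.1)
      have h3 := l.rowLen_anti p x.1 (not_lt.1 hp)
      omega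
  have h2 : ∑ q ∈ Finset.range p, l.rowLen q =
      p * l.rowLen p + ∑ q ∈ Finset.range p, (l.rowLen q - l.rowLen p) := by
    have h3 : p * l.rowLen p = ∑ _q ∈ Finset.range p, l.rowLen p := by simp
    rw [h3, ← Finset.sum_add_distrib]
    refine Finset.sum_congr rfl fun q hq => ?_
    have := l.rowLen_anti q p (Finset.mem_range.1 hq).le
    omega
  omega

/-- For the p-th partial sum the right choice is k = `l.rowLen p`: row sizes satisfy a ≤ k + (a -
k)₊, and for `l` this k makes the corresponding bound sharp. -/
theorem RowStandardTableau.subquotientShape_dominatedBy {Y : YoungDiagram}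
    (τ : RowStandardTableau Y) {i j : ℕ} {l : YoungDiagram}
    (h : ∀ k, ∑ r ∈ Finset.range (Y.colLen 0), (τ.rowSize i j r - k) ≤ l.cardFromCol k) :
    DominatedBy (τ.subquotientShape i j) l := by
  intro p
  refine le_trans ?_ (l.mul_add_cardFromCol_le p)
  refine le_trans ?_ (Nat.add_le_add_left (h (l.rowLen p)) _)
  generalize l.rowLen p = k
  unfold RowStandardTableau.subquotientShape
  simp only [YoungDiagram.rowLen_ofRowLens_getD]
  have h1 := List.sum_range_getD_le_sum_map (fun a => a - k)
    (((Multiset.range (Y.colLen 0)).map (τ.rowSize i j)).sort (· ≥ ·)) (Nat.zero_sub k) p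
  have h2 : ((((Multiset.range (Y.colLen 0)).map (τ.rowSize i j)).sort (· ≥ ·)).map
      fun a => a - k).sum = ∑ r ∈ Finset.range (Y.colLen 0), (τ.rowSize i j r - k) := by
    rw [← Multiset.sum_coe, ← Multiset.map_coe, Multiset.sort_eq, Multiset.map_map]
    rfl
  rw [h2] at h1
  refine le_trans ?_ (Nat.add_le_add_left h1 _)
  have h3 : p * k = ∑ _q ∈ Finset.range p, k := by simp
  rw [h3, ← Finset.sum_add_distrib]
  exact Finset.sum_le_sum fun q _ => by omega

theorem mainTheorem2 (Y : YoungDiagram) :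
    setK Y ⊆ setR Y ∧
    ∀ (u : Module.End ℂ (Fin Y.card → ℂ)) (e : Module.Basis Y.cells ℂ (Fin Y.card → ℂ)),
      IsJordanBasis u e →
      ∀ (τ : RowStandardTableau Y) (T : StandardTableau Y),
        tableauFlag e τ ∈ springerComponent u T →
        ∀ i j : ℕ, i < j → j ≤ Y.card →
          DominatedBy (τ.subquotientShape i j) (T.subquotientShape i j) := by
  have key : ∀ (u : Module.End ℂ (Fin Y.card → ℂ))
      (e : Module.Basis Y.cells ℂ (Fin Y.card → ℂ)), IsJordanBasis u e →
      ∀ (τ : RowStandardTableau Y) (T : StandardTableau Y),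
        tableauFlag e τ ∈ springerComponent u T →
        ∀ i j : ℕ, i < j → j ≤ Y.card →
          DominatedBy (τ.subquotientShape i j) (T.subquotientShape i j) := by
    intro u e he τ T hF i j hij hj
    refine τ.subquotientShape_dominatedBy fun k => ?_
    have h1 := sum_rowSize_le_finrank he τ hij hj k
    have h2 := finrank_le_of_mem_springerComponent he.isNilpotent hF hij hj k
    omega
  refine ⟨?_, key⟩
  rintro ⟨τ, T⟩ hp
  obtain ⟨u, e, he⟩ := exists_isJordanBasis Y
  exact key u e he τ T (hp u e he)
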